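/- Identify $\mathbb{C}^n$ with $\mathbb{R}^n\times i\mathbb{R}^n$, let $\pi\colon\mathbb{C}^n\to\mathbb{R}^n$, $\pi(x+iy)=x$, and let $J$ denote multiplication by $i$ on tangent vectors. A current of dimension $2$ on $\mathbb{C}^n$ is a continuous linear functional $T$ on the space of smooth real $2$-forms with compact support; its mass is the supremum of $T(\alpha)$ over such forms $\alpha$ of comass at most $1$ at every point. It has bidimension $(1,1)$ if it vanishes on forms without $(1,1)$-component, and such a $T$ is positive if $T(\alpha)\ge 0$ for every compactly supported smooth real $(1,1)$-form $\alpha$ with $\alpha(\nu,J\nu)\ge 0$ for all tangent vectors $\nu$. With $d^c=i(\bar\partial-\partial)$, the distribution $dd^cT$ is defined by $(dd^cT)(u)=T(dd^cu)$ for $u\in C_c^\infty(\mathbb{C}^n)$; it is $\le 0$ on an open set $\Omega$ if $T(dd^cu)\le 0$ for all $u\ge 0$ in $C_c^\infty(\Omega)$. Let $K\subset\mathbb{R}^n$ be a connected compact set, let $\mathrm{Co}(K)$ be its convex hull, and let $\mathcal{T}_K=K\times i\mathbb{R}^n$. (1) For every point $z_0=p+iq\in\mathbb{C}^n$ with $p\in\mathrm{Co}(K)$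 there exist a positive current $T$ of bidimension $(1,1)$ on $\mathbb{C}^n$ with finite mass and a probability measure $\mu$ on $\mathcal{T}_K$ such that $\mathrm{supp}\,T\subset\mathrm{Co}(K)\times i\mathbb{R}^n$ and $dd^cT=\mu-\delta_{z_0}$, where $\delta_{z_0}$ is the Dirac mass at $z_0$. (2) Conversely, let $T$ be a positive current of bidimension $(1,1)$ on $\mathbb{C}^n$ with finite mass such that $\pi(\mathrm{supp}\,T)$ is a bounded subset of $\mathbb{R}^n$. If $dd^cT\le 0$ on $\mathbb{C}^n\setminus\mathcal{T}_K$, then $\mathrm{supp}\,T\subset\mathrm{Co}(K)\times i\mathbb{R}^n$. -/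

import Mathlib

open MeasureTheory Distribution
open scoped Distributions ENNReal

noncomputable section

namespace Bochner

/-- `ℂⁿ` with its Euclidean norm. -/
abbrev Cn (n : ℕ) : Type := EuclideanSpace ℂ (Fin n)

/-- `ℝⁿ` with its Euclidean norm. -/
abbrev Rn (n : ℕ) : Type := EuclideanSpace ℝ (Fin n)

/-- Real alternating `k`-covectors on the real vector space `ℂⁿ ≅ ℝ²ⁿ`. On `2`-covectors the
operator norm is the comass: it is the supremum of `|a(v, w)|` over unit vectors `v, w`, and it is
attained at orthonormal pairs. -/
abbrev Covector (n k : ℕ) : Type := Cn n [⋀^Fin k]→L[ℝ] ℝ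

/-- Smooth real differential `k`-forms with compact support on `ℂⁿ`. -/
abbrev TestForm (n k : ℕ) : Type := 𝓓((⊤ : TopologicalSpace.Opens (Cn n)), Covector n k)

/-- Smooth real functions with compact support on `ℂⁿ`. -/
abbrev TestFn (n : ℕ) : Type := 𝓓((⊤ : TopologicalSpace.Opens (Cn n)), ℝ)

/-- Currents of dimension two on `ℂⁿ`: continuous linear functionals on the space of test
`2`-forms. -/
abbrev Current (n : ℕ) : Type := TestForm n 2 →L[ℝ] ℝ

/-- The projection `π(x + iy) = x` from `ℂⁿ` to `ℝⁿ`. -/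
def rePart {n : ℕ} (z : Cn n) : Rn n := WithLp.toLp 2 fun j => (z j).re

/-- The tube `S × iℝⁿ` over a subset `S` of `ℝⁿ`. -/
def tube {n : ℕ} (S : Set (Rn n)) : Set (Cn n) := {z | rePart z ∈ S}

/-- The standard complex structure `J v = i v` as a real linear operator. -/
def complexStructure (n : ℕ) : Cn n →L[ℝ] Cn n :=
  (Complex.I • ContinuousLinearMap.id ℂ (Cn n)).restrictScalars ℝ

/-- The pointwise operation `ℓ ↦ -ℓ ∘ J` from linear forms to `1`-covectors. -/
def negCompJ (n : ℕ) : (Cn n →L[ℝ] ℝ) →L[ℝ] Covector n 1 :=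
  ((ContinuousAlternatingMap.ofSubsingletonLIE (𝕜 := ℝ) (E := Cn n) (F := ℝ)
    (0 : Fin 1)).toContinuousLinearEquiv : (Cn n →L[ℝ] ℝ) →L[ℝ] Covector n 1) ∘L
    (-((ContinuousLinearMap.compL ℝ (Cn n) (Cn n) ℝ).flip (complexStructure n)))

/-- The operator `d^c = i(∂̄ - ∂)` on test functions; on real functions it is
`d^c u = -du ∘ J`. -/
def dc (n : ℕ) : TestFn n →L[ℝ] TestForm n 1 :=
  TestFunction.postcompCLM (negCompJ n) ∘L TestFunction.fderivCLM ℝ ⊤ ⊤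

/-- The exterior derivative from test `1`-forms to test `2`-forms. -/
def extD (n : ℕ) : TestForm n 1 →L[ℝ] TestForm n 2 :=
  TestFunction.postcompCLM (ContinuousAlternatingMap.alternatizeUncurryFinCLM ℝ (Cn n) ℝ) ∘L
    TestFunction.fderivCLM ℝ ⊤ ⊤

/-- The operator `dd^c = 2i∂∂̄` from test functions to test `2`-forms. -/
def ddc (n : ℕ) : TestFn n →L[ℝ] TestForm n 2 := extD n ∘L dc n

theorem dc_apply {n : ℕ} (φ : TestFn n) (z v : Cn n) :
    dc n φ z ![v] = -fderiv ℝ φ z (Complex.I • v) := by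
  simp [dc, negCompJ, complexStructure]

theorem extD_apply {n : ℕ} (ω : TestForm n 1) (z : Cn n) : extD n ω z = extDeriv ω z := by
  simp [extD, extDeriv]

/-- The distribution `dd^c T`, given by `(dd^c T)(u) = T(dd^c u)`. -/
def ddcCurrent {n : ℕ} (T : Current n) : TestFn n →L[ℝ] ℝ := T ∘L ddc n

/-- A form of type `(1,1)`. For real forms this means that the form is invariant under `J`. -/
def IsTypeOneOne {n : ℕ} (α : TestForm n 2) : Prop :=
  ∀ z v w : Cn n, α z ![Complex.I • v, Complex.I • w] = α z ![v, w]

/-- A form without `(1,1)` component, that is, a sum of forms of types `(2,0)` and `(0,2)`. For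
real forms this means that `J` changes the sign of the form. -/
def IsTypeTwoZeroZeroTwo {n : ℕ} (α : TestForm n 2) : Prop :=
  ∀ z v w : Cn n, α z ![Complex.I • v, Complex.I • w] = -α z ![v, w]

/-- A positive form: it is nonnegative on every pair `ν, Jν`. -/
def IsPositiveForm {n : ℕ} (α : TestForm n 2) : Prop :=
  ∀ z ν : Cn n, 0 ≤ α z ![ν, Complex.I • ν]

/-- A current of bidimension `(1,1)`: it only sees the `(1,1)` component of a form. -/
def HasBidimensionOneOne {n : ℕ} (T : Current n) : Prop :=
  ∀ α : TestForm n 2, IsTypeTwoZeroZeroTwo α → T α = 0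

/-- A positive current of bidimension `(1,1)`. -/
structure IsPositiveCurrent {n : ℕ} (T : Current n) : Prop where
  bidimension : HasBidimensionOneOne T
  nonneg : ∀ α : TestForm n 2, IsTypeOneOne α → IsPositiveForm α → 0 ≤ T α

/-- The mass of a current: the supremum of its values on test forms of comass at most `1`. -/
def mass {n : ℕ} (T : Current n) : ℝ≥0∞ :=
  ⨆ (α : TestForm n 2) (_ : ∀ z, ‖α z‖ ≤ 1), ENNReal.ofReal (T α)

/-- A distribution is nonpositive on `Ω`: it is nonpositive on nonnegative test functions with
support in `Ω`. -/
def IsNonposOn {n : ℕ} (D : TestFn n →L[ℝ] ℝ) (Ω : Set (Cn n)) : Prop :=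
  ∀ φ : TestFn n, tsupport φ ⊆ Ω → (∀ z, 0 ≤ φ z) → D φ ≤ 0

end Bochner

end

/-! Part (2) is a maximum principle. If `p` lies outside the hull, a hyperplane separating `p` from
`K`, bent slightly by `δ‖x - p‖²`, gives a strictly convex quadratic `q` with `q < 0` on `K` and `q
p > 0`. Composed with the real part, `q` is strictly plurisubharmonic in all complex directions
(`levi_reQuadratic`). For a smooth convex `χ` vanishing exactly on `(-∞, 0]`, the function `u =
χ(q(Re z))` is nonnegative and plurisubharmonic, is supported off the tube, and is strictly
plurisubharmonic where `q > 0`. Formally `T(dd^c u) ≤ 0` by hypothesis and `T(dd^c u) ≥ 0` by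
positivity, so `T` does not charge `{q > 0}`. Since `u` is not compactly supported, it is multiplied
by cutoffs whose first two derivatives are at most `ε`; the error is `ε` times the mass of `T`
(`apply_nonpos_of_strictly_psh`). Bounded real parts on the support keep `u` and `du` bounded there.

Part (1) takes limits of holomorphic discs. Integrating forms over a disc `f` with `f 0 = z₀`
against the Green function of the unit disc gives a positive current whose `dd^c` is the
push-forward of normalized arc length minus `δ_{z₀}` (`discIntegral_ddc`). Since `K` is connected,
`p` is nearly the mean of a loop close to `K`; approximating the loop by real parts of polynomials
and recentering gives discs through `z₀` with boundary nearly in the tube (`exists_disc`). Green's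
formula for `‖Re z‖²` bounds the masses by the boundary real parts alone (`abs_discIntegral_le`),
and also bounds the second moments of the boundary measures (`circleAverage_norm_sq_le`), so these
are tight and a limit pair `(T, μ)` exists. The maximum principle for real parts locates the support
of `T`. -/

noncomputable section

namespace Bochner

set_option maxSynthPendingDepth 3

/-! ### Calculus of the Levi form -/

section Levi

variable {E : Type*} [NormedAddCommGroup E] [NormedSpace ℂ E]

/-- The value of the Levi form `dd^c f` on the pair `(ν, Jν)`. -/
def levi (f : E → ℝ) (z ν : E) : ℝ :=
  fderiv ℝ (fderiv ℝ f) z ν ν +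
    fderiv ℝ (fderiv ℝ f) z (Complex.I • ν) (Complex.I • ν)

theorem differentiable_fderiv_of_contDiff_two {G : Type*} [NormedAddCommGroup G] [NormedSpace ℝ G]
    {f : E → G} (hf : ContDiff ℝ 2 f) : Differentiable ℝ (fderiv ℝ f) :=
  (hf.fderiv_right (m := 1) (by norm_num)).differentiable (by norm_num)

theorem fderiv_fderiv_eq {f : E → ℝ} (hf : ContDiff ℝ 2 f) (z v w : E) :
    fderiv ℝ (fderiv ℝ f) z v w = fderiv ℝ (fun y => fderiv ℝ f y w) z v := by
  have h := (differentiable_fderiv_of_contDiff_two hf z).hasFDerivAt.clm_apply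
    (hasFDerivAt_const w z)
  rw [h.fderiv]; simp

theorem fderiv_fderiv_mul {f g : E → ℝ} (hf : ContDiff ℝ 2 f) (hg : ContDiff ℝ 2 g) (z v : E) :
    fderiv ℝ (fderiv ℝ fun y => f y * g y) z v v =
      f z * fderiv ℝ (fderiv ℝ g) z v v + g z * fderiv ℝ (fderiv ℝ f) z v v +
        2 * (fderiv ℝ f z v * fderiv ℝ g z v) := by
  have hf1 : Differentiable ℝ f := hf.differentiable (by norm_num)
  have hg1 : Differentiable ℝ g := hg.differentiable (by norm_num)
  have e : (fderiv ℝ fun y => f y * g y) = fun y => f y • fderiv ℝ g y + g y • fderiv ℝ f y := by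
    funext y
    exact fderiv_fun_mul (hf1 y) (hg1 y)
  have h := ((hf1 z).hasFDerivAt.smul (differentiable_fderiv_of_contDiff_two hg z).hasFDerivAt).add
    ((hg1 z).hasFDerivAt.smul (differentiable_fderiv_of_contDiff_two hf z).hasFDerivAt)
  have h2 := h.fderiv
  rw [e]
  erw [h2]
  simp
  ring

theorem levi_mul {f g : E → ℝ} (hf : ContDiff ℝ 2 f) (hg : ContDiff ℝ 2 g) (z ν : E) :
    levi (fun y => f y * g y) z ν = f z * levi g z ν + g z * levi f z ν +
      2 * (fderiv ℝ f z ν * fderiv ℝ g z ν +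
        fderiv ℝ f z (Complex.I • ν) * fderiv ℝ g z (Complex.I • ν)) := by
  simp only [levi, fderiv_fderiv_mul hf hg]
  ring

theorem fderiv_fderiv_comp_real {χ : ℝ → ℝ} {h : E → ℝ} (hχ : ContDiff ℝ 2 χ)
    (hh : ContDiff ℝ 2 h) (z v : E) :
    fderiv ℝ (fderiv ℝ fun y => χ (h y)) z v v =
      deriv (deriv χ) (h z) * (fderiv ℝ h z v) ^ 2 +
        deriv χ (h z) * fderiv ℝ (fderiv ℝ h) z v v := by
  have hh1 : Differentiable ℝ h := hh.differentiable (by norm_num)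
  have hχ1 : Differentiable ℝ χ := hχ.differentiable (by norm_num)
  have hχ2 : Differentiable ℝ (deriv χ) :=
    (contDiff_succ_iff_deriv (n := 1).1 hχ).2.2.differentiable (by norm_num)
  have e : (fderiv ℝ fun y => χ (h y)) = fun y => deriv χ (h y) • fderiv ℝ h y := by
    funext y
    exact ((hχ1 (h y)).hasDerivAt.comp_hasFDerivAt y (hh1 y).hasFDerivAt).fderiv
  have h3 := ((hχ2 (h z)).hasDerivAt.comp_hasFDerivAt z (hh1 z).hasFDerivAt).smul
    (differentiable_fderiv_of_contDiff_two hh z).hasFDerivAt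
  rw [e]
  erw [h3.fderiv]
  simp
  ring

theorem levi_comp_real {χ : ℝ → ℝ} {h : E → ℝ} (hχ : ContDiff ℝ 2 χ) (hh : ContDiff ℝ 2 h)
    (z ν : E) :
    levi (fun y => χ (h y)) z ν =
      deriv (deriv χ) (h z) * ((fderiv ℝ h z ν) ^ 2 + (fderiv ℝ h z (Complex.I • ν)) ^ 2) +
        deriv χ (h z) * levi h z ν := by
  simp only [levi, fderiv_fderiv_comp_real hχ hh]
  ring

/-- The second derivative of `f` enters through `du(a² f'')` in direction `a`; the contributions of
`a = 1` and `a = i` cancel because `1 + i² = 0`. -/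
theorem levi_comp_holomorphic {u : E → ℝ} {f : ℂ → E} (hu : ContDiff ℝ 2 u)
    (hf : ContDiff ℂ 2 f) (ζ : ℂ) :
    levi (fun w => u (f w)) ζ 1 = levi u (f ζ) (deriv f ζ) := by
  have hf1 : Differentiable ℂ f := hf.differentiable (by norm_num)
  have hf2 : Differentiable ℂ (deriv f) :=
    (contDiff_succ_iff_deriv (n := 1).1 hf).2.2.differentiable (by norm_num)
  have hu1 : Differentiable ℝ u := hu.differentiable (by norm_num)
  have hfr : ∀ w, HasFDerivAt f (((1 : ℂ →L[ℂ] ℂ).smulRight (deriv f w)).restrictScalars ℝ) w :=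
    fun w => (hf1 w).hasDerivAt.hasFDerivAt.restrictScalars ℝ
  have hf2r : HasFDerivAt (deriv f)
      (((1 : ℂ →L[ℂ] ℂ).smulRight (deriv (deriv f) ζ)).restrictScalars ℝ) ζ :=
    (hf2 ζ).hasDerivAt.hasFDerivAt.restrictScalars ℝ
  have huf : ContDiff ℝ 2 fun w => u (f w) := hu.comp (hf.restrict_scalars ℝ)
  have key : ∀ a : ℂ, fderiv ℝ (fderiv ℝ fun w => u (f w)) ζ a a =
      fderiv ℝ (fderiv ℝ u) (f ζ) (a • deriv f ζ) (a • deriv f ζ) +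
        fderiv ℝ u (f ζ) ((a * a) • deriv (deriv f) ζ) := by
    intro a
    rw [fderiv_fderiv_eq huf]
    have e : (fun y => fderiv ℝ (fun w => u (f w)) y a) =
        fun y => fderiv ℝ u (f y) (a • deriv f y) := by
      funext y
      have := ((hu1 (f y)).hasFDerivAt.comp y (hfr y)).fderiv
      erw [this]
      simp
    have h1 := ((differentiable_fderiv_of_contDiff_two hu (f ζ)).hasFDerivAt.comp ζ
      (hfr ζ)).clm_apply (hf2r.const_smul a)
    rw [e]
    erw [h1.fderiv]
    simp [smul_smul]
    ring
  simp only [levi, key]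
  simp
  ring

end Levi

end Bochner

/-! ### Positivity, mass and support of currents -/

namespace Bochner

set_option maxSynthPendingDepth 3

variable {n : ℕ}

/-- A smooth compactly supported map as a test function. -/
def toTest {F : Type*} [NormedAddCommGroup F] [NormedSpace ℝ F] (f : Cn n → F)
    (hf : ContDiff ℝ (⊤ : ℕ∞) f) (hc : HasCompactSupport f) :
    𝓓((⊤ : TopologicalSpace.Opens (Cn n)), F) :=
  ⟨f, hf, hc, fun _ _ => trivial⟩

/-- The product of a smooth function and a test form. -/
def smulForm {k : ℕ} (g : Cn n → ℝ) (hg : ContDiff ℝ (⊤ : ℕ∞) g) (α : TestForm n k) :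
    TestForm n k :=
  toTest (fun z => g z • α z) (ContDiff.smul hg α.contDiff)
    (HasCompactSupport.smul_left (f := g) α.hasCompactSupport)

@[simp]
theorem smulForm_apply {k : ℕ} (g : Cn n → ℝ) (hg : ContDiff ℝ (⊤ : ℕ∞) g) (α : TestForm n k)
    (z : Cn n) : smulForm g hg α z = g z • α z := rfl

theorem I_smul_I_smul (v : Cn n) : Complex.I • Complex.I • v = -v := by
  rw [smul_smul, Complex.I_mul_I, neg_one_smul]

theorem covector_neg_right (a : Covector n 2) (v w : Cn n) : a ![v, -w] = -a ![v, w] := by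
  have := a.map_update_smul ![v, w] 1 (-1 : ℝ) w
  have e : ∀ x : Cn n, Function.update ![v, w] 1 x = ![v, x] := by
    intro x; ext i; fin_cases i <;> simp
  rw [e, e] at this
  simpa using this

theorem covector_swap (a : Covector n 2) (v w : Cn n) : a ![w, v] = -a ![v, w] := by
  have := a.toAlternatingMap.map_swap ![v, w] (i := 0) (j := 1) (by decide)
  have e : ![v, w] ∘ Equiv.swap (0 : Fin 2) 1 = ![w, v] := by
    funext i; fin_cases i <;> rfl
  rw [e] at this
  exact this

/-- The pointwise pullback of a `2`-covector by `J`. -/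
def compJ (n : ℕ) : Covector n 2 →L[ℝ] Covector n 2 :=
  ContinuousAlternatingMap.compContinuousLinearMapCLM (complexStructure n)

theorem compJ_apply (a : Covector n 2) (v w : Cn n) :
    compJ n a ![v, w] = a ![Complex.I • v, Complex.I • w] := by
  simp only [compJ, ContinuousAlternatingMap.compContinuousLinearMapCLM_apply,
    ContinuousAlternatingMap.compContinuousLinearMap_apply]
  congr 1
  funext i
  fin_cases i <;> rfl

/-- With `β = J^*α`, the form `α - β` has no `(1,1)` part, so `T α = T β`, while `α + β` is of type
`(1,1)` and doubles the values of `α` on pairs `(ν, Jν)`. Thus positivity may be tested without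
checking the type of a form. -/
theorem IsPositiveCurrent.nonneg_of_isPositiveForm {T : Current n} (hT : IsPositiveCurrent T)
    (α : TestForm n 2) (hα : IsPositiveForm α) : 0 ≤ T α := by
  set β : TestForm n 2 := TestFunction.postcompCLM (compJ n) α with hβ
  have hβa : ∀ z v w, β z ![v, w] = α z ![Complex.I • v, Complex.I • w] := by
    intro z v w
    simp [hβ, compJ_apply]
  have h1 : T (α - β) = 0 := by
    apply hT.bidimension
    intro z v w
    change (α z - β z) _ = -(α z - β z) _
    simp only [ContinuousAlternatingMap.sub_apply, hβa, I_smul_I_smul, covector_neg_right]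
    rw [covector_swap _ w (-v), covector_neg_right, covector_swap _ v w]
    ring
  have h2 : 0 ≤ T (α + β) := by
    apply hT.nonneg
    · intro z v w
      change (α z + β z) _ = (α z + β z) _
      simp only [ContinuousAlternatingMap.add_apply, hβa, I_smul_I_smul, covector_neg_right]
      rw [covector_swap _ w (-v), covector_neg_right, covector_swap _ v w]
      ring
    · intro z v
      change 0 ≤ (α z + β z) _
      simp only [ContinuousAlternatingMap.add_apply, hβa, I_smul_I_smul, covector_neg_right]
      rw [covector_swap _ v (Complex.I • v)]
      have := hα z v
      linarith
  rw [map_sub] at h1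
  rw [map_add] at h2
  linarith

theorem ddc_apply_I (φ : TestFn n) (z ν : Cn n) :
    ddc n φ z ![ν, Complex.I • ν] = levi φ z ν := by
  have hd : Differentiable ℝ (dc n φ) := (dc n φ).contDiff.differentiable (by simp)
  have h : ∀ v w, fderiv ℝ (dc n φ) z v ![w] = -fderiv ℝ (fderiv ℝ φ) z v (Complex.I • w) := by
    intro v w
    have hφ : ContDiff ℝ 2 φ := φ.contDiff.of_le (WithTop.coe_le_coe.2 le_top)
    have h1 := (((ContinuousAlternatingMap.apply ℝ (Cn n) ℝ ![w])).hasFDerivAt.comp z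
      (hd z).hasFDerivAt).fderiv
    have e : (fun y => dc n φ y ![w]) = fun y => -fderiv ℝ φ y (Complex.I • w) := by
      funext y; exact dc_apply φ y w
    rw [fderiv_fderiv_eq hφ]
    have h2 : fderiv ℝ (fun y => dc n φ y ![w]) z v = fderiv ℝ (dc n φ) z v ![w] := by
      erw [h1]; rfl
    rw [← h2, e, fderiv_fun_neg]; rfl
  change extD n (dc n φ) z _ = _
  rw [extD_apply, extDeriv, ContinuousAlternatingMap.alternatizeUncurryFin_apply]
  rw [Fin.sum_univ_two]
  have e0 : Fin.removeNth (0 : Fin 2) ![ν, Complex.I • ν] = ![Complex.I • ν] := by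
    funext i; fin_cases i; rfl
  have e1 : Fin.removeNth (1 : Fin 2) ![ν, Complex.I • ν] = ![ν] := by
    funext i; fin_cases i; rfl
  rw [e0, e1]
  simp [h, levi, I_smul_I_smul]

theorem apply_le_of_mass {T : Current n} (hm : mass T < ⊤) (α : TestForm n 2) {c : ℝ}
    (hα : ∀ z, ‖α z‖ ≤ c) : T α ≤ (mass T).toReal * c := by
  have key : ∀ c : ℝ, 0 < c → (∀ z, ‖α z‖ ≤ c) → T α ≤ (mass T).toReal * c := by
    intro c hc hα
    have h1 : ∀ z, ‖(c⁻¹ • α) z‖ ≤ 1 := by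
      intro z
      change ‖c⁻¹ • α z‖ ≤ 1
      rw [norm_smul, norm_inv, Real.norm_of_nonneg hc.le]
      exact inv_mul_le_one_of_le₀ (hα z) hc.le
    have h2 : ENNReal.ofReal (T (c⁻¹ • α)) ≤ mass T :=
      le_iSup₂ (f := fun (α : TestForm n 2) (_ : ∀ z, ‖α z‖ ≤ 1) => ENNReal.ofReal (T α)) _ h1
    have h3 := (ENNReal.ofReal_le_iff_le_toReal hm.ne).1 h2
    rw [map_smul, smul_eq_mul, inv_mul_le_iff₀ hc] at h3
    linarith
  have hc : 0 ≤ c := (norm_nonneg _).trans (hα 0)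
  have hM : 0 ≤ (mass T).toReal := ENNReal.toReal_nonneg
  -- Dividing by `c` is impossible for `c = 0`, so `key` is applied to a slightly larger bound.
  refine le_of_forall_pos_le_add fun ε hε => ?_
  have h := key (c + ε / ((mass T).toReal + 1)) (by positivity)
    (fun z => (hα z).trans (by simp; positivity))
  refine h.trans ?_
  rw [mul_add]
  gcongr
  rw [mul_div_left_comm]
  exact mul_le_of_le_one_right hε.le ((div_le_one (by positivity)).2 (by linarith))

/-- A current vanishes on test forms supported off its support. -/
theorem apply_eq_zero_of_disjoint_dsupport (T : Current n) (α : TestForm n 2)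
    (h : Disjoint (tsupport α) (dsupport T)) : T α = 0 := by
  have hx : ∀ x ∈ tsupport α, ∃ s : Set (Cn n), IsVanishingOn T s ∧ IsOpen s ∧ x ∈ s :=
    fun x hx => (notMem_dsupport_iff (f := T) x).1 (Set.disjoint_left.1 h hx)
  choose! s hs using hx
  obtain ⟨t, ht, hts⟩ := α.hasCompactSupport.elim_nhds_subcover s
    (fun x hx => (hs x hx).2.1.mem_nhds (hs x hx).2.2)
  -- Finitely many open sets on which `T` vanishes cover the support of `α`; a subordinate partition
  -- of unity cuts `α` into pieces that `T` kills.
  obtain ⟨f, hf⟩ := SmoothPartitionOfUnity.exists_isSubordinate (modelWithCornersSelf ℝ (Cn n))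
    (s := tsupport α) (isClosed_tsupport α) (fun i : t => s i)
    (fun i => (hs i (ht i i.2)).2.1) (fun x hx => by
      obtain ⟨i, hi, hxi⟩ := Set.mem_iUnion₂.1 (hts hx)
      exact Set.mem_iUnion.2 ⟨⟨i, hi⟩, hxi⟩)
  have hsm : ∀ i, ContDiff ℝ (⊤ : ℕ∞) (f i) := fun i => (f i).contMDiff.contDiff
  have e : α = ∑ i : t, smulForm (f i) (hsm i) α := by
    apply TestFunction.ext
    intro z
    have e1 : (∑ i : t, smulForm (f i) (hsm i) α) z = ∑ i : t, f i z • α z := by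
      exact map_sum (AddMonoidHom.mk' (fun β : TestForm n 2 => β z) fun _ _ => rfl) _ _
    rw [e1, ← Finset.sum_smul]
    by_cases hz : z ∈ tsupport α
    · have := f.sum_eq_one hz
      rw [finsum_eq_sum_of_fintype] at this
      rw [this, one_smul]
    · rw [image_eq_zero_of_notMem_tsupport hz, smul_zero]
  rw [e, map_sum]
  refine Finset.sum_eq_zero fun i _ => (hs i (ht i i.2)).1 _ ?_
  exact (tsupport_smul_subset_left _ _).trans (hf i)

/-- Multiplication by a function that equals one near the support does not change a current. -/
theorem apply_smulForm_eq (T : Current n) (α : TestForm n 2) (g : Cn n → ℝ)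
    (hg : ContDiff ℝ (⊤ : ℕ∞) g) {U : Set (Cn n)} (hU : IsOpen U) (hTU : dsupport T ⊆ U)
    (h1 : ∀ z ∈ U, g z = 1) : T (smulForm g hg α) = T α := by
  rw [eq_comm, ← sub_eq_zero, ← map_sub]
  apply apply_eq_zero_of_disjoint_dsupport
  refine Disjoint.mono_right hTU (Disjoint.closure_left ?_ hU)
  rw [Set.disjoint_left]
  intro z hz hzU
  apply hz
  change α z - g z • α z = 0
  simp [h1 z hzU]

end Bochner

/-! ### Functions of the real part, cutoffs and the Kähler covector -/

namespace Bochner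

set_option maxSynthPendingDepth 3

variable {n : ℕ}

/-- The projection `π` as a real linear map. -/
def rePartL (n : ℕ) : Cn n →L[ℝ] Rn n :=
  LinearMap.toContinuousLinearMap
    { toFun := rePart
      map_add' := fun x y => by ext i; simp [rePart]
      map_smul' := fun c x => by ext i; simp [rePart] }

@[simp]
theorem rePartL_apply (z : Cn n) : rePartL n z = rePart z := rfl

theorem continuous_rePart : Continuous (rePart : Cn n → Rn n) := (rePartL n).continuous

/-- Pythagoras, since `Re(iν) = -Im ν`. -/
theorem norm_rePart_sq_add (ν : Cn n) :
    ‖rePart ν‖ ^ 2 + ‖rePart (Complex.I • ν)‖ ^ 2 = ‖ν‖ ^ 2 := by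
  simp only [EuclideanSpace.norm_sq_eq, rePart, ← Finset.sum_add_distrib]
  refine Finset.sum_congr rfl fun i _ => ?_
  simp only [Real.norm_eq_abs, sq_abs, PiLp.smul_apply, smul_eq_mul, Complex.sq_norm,
    Complex.normSq_apply, Complex.I_mul_re]
  ring

/-- A convex quadratic function of the real part. -/
def reQuadratic (e : Rn n) (c δ : ℝ) (p x : Rn n) : ℝ :=
  inner ℝ e x - c + δ * ‖x - p‖ ^ 2

theorem contDiff_reQuadratic (e : Rn n) (c δ : ℝ) (p : Rn n) {k : WithTop ℕ∞} :
    ContDiff ℝ k (reQuadratic e c δ p) := by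
  unfold reQuadratic
  have h1 : ContDiff ℝ k fun x : Rn n => ‖x - p‖ ^ 2 := (contDiff_id.sub contDiff_const).norm_sq ℝ
  have h2 : ContDiff ℝ k fun x : Rn n => inner ℝ e x := contDiff_const.inner ℝ contDiff_id
  exact (h2.sub contDiff_const).add (contDiff_const.mul h1)

/-- The affine part is pluriharmonic, and the Hessian of `‖Re z - p‖²` sees `Re ν` and `Re(iν)`,
which together recover all of `ν`. With `δ` small this gives the separating function of part (2);
with `δ = 1` it measures the area of discs in part (1). -/
theorem levi_reQuadratic (e : Rn n) (c δ : ℝ) (p : Rn n) (z ν : Cn n) :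
    levi (fun z : Cn n => reQuadratic e c δ p (rePart z)) z ν = 2 * δ * ‖ν‖ ^ 2 := by
  have hh : ContDiff ℝ 2 fun z : Cn n => reQuadratic e c δ p (rePart z) :=
    (contDiff_reQuadratic e c δ p).comp (rePartL n).contDiff
  have h1 : ∀ z v : Cn n, fderiv ℝ (fun z : Cn n => reQuadratic e c δ p (rePart z)) z v =
      inner ℝ e (rePart v) + δ * (2 * inner ℝ (rePart z - p) (rePart v)) := by
    intro z v
    have hl : HasFDerivAt (fun z : Cn n => rePart z - p) (rePartL n) z :=
      (rePartL n).hasFDerivAt.sub_const p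
    have := (((innerSL ℝ e ∘L rePartL n).hasFDerivAt (x := z)).sub_const c).add
      (hl.norm_sq.const_mul δ)
    erw [this.fderiv]
    simp [inner_sub_left]
  have h2 : ∀ v : Cn n, fderiv ℝ (fderiv ℝ fun z : Cn n => reQuadratic e c δ p (rePart z)) z v v =
      2 * δ * ‖rePart v‖ ^ 2 := by
    intro v
    rw [fderiv_fderiv_eq hh]
    simp only [h1]
    have hl : HasFDerivAt (fun z : Cn n => rePart z - p) (rePartL n) z :=
      (rePartL n).hasFDerivAt.sub_const p
    have := ((((hl.inner ℝ (hasFDerivAt_const (rePart v) z)).const_mul 2).const_mul δ).const_add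
      (inner ℝ e (rePart v)))
    erw [this.fderiv]
    simp
    ring
  simp only [levi, h2]
  rw [← norm_rePart_sq_add ν]
  ring

/-- A smooth convex function that vanishes exactly on the nonpositive half-line. -/
theorem exists_smooth_convex_vanishing : ∃ χ : ℝ → ℝ, ContDiff ℝ (⊤ : ℕ∞) χ ∧
    (∀ t ≤ 0, χ t = 0) ∧ (∀ t, 0 ≤ χ t) ∧ (∀ t, 0 ≤ deriv χ t) ∧ (∀ t, 0 ≤ deriv (deriv χ) t) ∧
    ∀ t, 0 < t → 0 < deriv χ t := by
  -- A primitive from `0` preserves smoothness, vanishing on `t ≤ 0` and positivity on `t > 0`. Two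
  -- primitives of `expNegInvGlue` give `χ`, so that `χ''` is `expNegInvGlue` itself.
  have prim : ∀ g : ℝ → ℝ, ContDiff ℝ (⊤ : ℕ∞) g → (∀ t ≤ 0, g t = 0) → (∀ t, 0 < t → 0 < g t) →
      ∃ G : ℝ → ℝ, ContDiff ℝ (⊤ : ℕ∞) G ∧ (∀ t ≤ 0, G t = 0) ∧ (∀ t, 0 < t → 0 < G t) ∧
        deriv G = g := by
    intro g hg h0 hp
    have hd : ∀ t, HasDerivAt (fun t => ∫ x in (0 : ℝ)..t, g x) (g t) t := fun t =>
      hg.continuous.integral_hasStrictDerivAt 0 t |>.hasDerivAt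
    have hde : deriv (fun t => ∫ x in (0 : ℝ)..t, g x) = g := funext fun t => (hd t).deriv
    refine ⟨fun t => ∫ x in (0 : ℝ)..t, g x, ?_, ?_, ?_, hde⟩
    · rw [contDiff_infty_iff_deriv, hde]
      exact ⟨fun t => (hd t).differentiableAt, hg⟩
    · intro t ht
      change ∫ x in (0 : ℝ)..t, g x = 0
      rw [intervalIntegral.integral_symm, neg_eq_zero]
      refine (intervalIntegral.integral_congr fun x hx => ?_).trans intervalIntegral.integral_zero
      rw [Set.uIcc_of_le ht] at hx
      exact h0 x hx.2
    · intro t ht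
      exact intervalIntegral.intervalIntegral_pos_of_pos_on (hg.continuous.intervalIntegrable _ _)
        (fun x hx => hp x hx.1) ht
  obtain ⟨G, hG, hG0, hGp, hGd⟩ := prim expNegInvGlue expNegInvGlue.contDiff
    (fun t => expNegInvGlue.zero_of_nonpos) (fun t => expNegInvGlue.pos_of_pos)
  obtain ⟨χ, hχ, hχ0, hχp, hχd⟩ := prim G hG hG0 hGp
  refine ⟨χ, hχ, hχ0, fun t => ?_, fun t => ?_, fun t => ?_, ?_⟩
  · rcases le_or_gt t 0 with h | h
    exacts [(hχ0 t h).ge, (hχp t h).le]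
  · rw [hχd]
    rcases le_or_gt t 0 with h | h
    exacts [(hG0 t h).ge, (hGp t h).le]
  · rw [hχd, hGd]
    exact expNegInvGlue.nonneg t
  · rw [hχd]
    exact hGp

theorem exists_bound_fderiv_fderiv {E : Type*} [NormedAddCommGroup E] [NormedSpace ℝ E]
    {f : E → ℝ} (hf : ContDiff ℝ (⊤ : ℕ∞) f) (hc : HasCompactSupport f) :
    ∃ C, 0 ≤ C ∧ (∀ z, ‖fderiv ℝ f z‖ ≤ C) ∧ ∀ z, ‖fderiv ℝ (fderiv ℝ f) z‖ ≤ C := by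
  have hf2 : ContDiff ℝ 2 f := hf.of_le (WithTop.coe_le_coe.2 le_top)
  have hf1 : ContDiff ℝ 1 (fderiv ℝ f) := hf2.fderiv_right (by norm_num)
  obtain ⟨C1, hC1⟩ := hf1.continuous.bounded_above_of_compact_support (hc.fderiv ℝ)
  obtain ⟨C2, hC2⟩ := (hf1.continuous_fderiv (by norm_num)).bounded_above_of_compact_support
    ((hc.fderiv ℝ).fderiv ℝ)
  exact ⟨max C1 C2, ((norm_nonneg _).trans (hC1 0)).trans (le_max_left _ _),
    fun z => (hC1 z).trans (le_max_left _ _), fun z => (hC2 z).trans (le_max_right _ _)⟩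

theorem norm_fderiv_comp_const_smul {E : Type*} [NormedAddCommGroup E] [NormedSpace ℝ E]
    {f : E → ℝ} (hf : ContDiff ℝ (⊤ : ℕ∞) f) {a : ℝ} (ha : 0 ≤ a) (z : E) :
    ‖fderiv ℝ (fun z => f (a • z)) z‖ = a * ‖fderiv ℝ f (a • z)‖ ∧
      ‖fderiv ℝ (fderiv ℝ fun z => f (a • z)) z‖ =
        a * (a * ‖fderiv ℝ (fderiv ℝ f) (a • z)‖) := by
  have hd1 : ∀ z, fderiv ℝ (fun z => f (a • z)) z = a • fderiv ℝ f (a • z) :=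
    fun z => fderiv_comp_smul a
  have hf2 : ContDiff ℝ 2 f := hf.of_le (WithTop.coe_le_coe.2 le_top)
  have hf1 : Differentiable ℝ (fderiv ℝ f) :=
    (hf2.fderiv_right (m := 1) (by norm_num)).differentiable (by norm_num)
  have h := ((hf1 (a • z)).hasFDerivAt.comp z
    ((hasFDerivAt_id (𝕜 := ℝ) z).const_smul a)).const_smul a
  have hd2 : fderiv ℝ (fderiv ℝ fun z => f (a • z)) z =
      a • a • fderiv ℝ (fderiv ℝ f) (a • z) := by
    rw [show (fderiv ℝ fun z => f (a • z)) = fun z => a • fderiv ℝ f (a • z) from funext hd1]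
    refine h.fderiv.trans ?_
    ext v w
    simp
  rw [hd1, hd2]
  simp only [norm_smul, Real.norm_of_nonneg ha, true_and]

/-- Cutoff functions with small derivatives. -/
theorem exists_cutoff {s : Set (Cn n)} (hs : IsCompact s) {ε : ℝ} (hε : 0 < ε) :
    ∃ η : Cn n → ℝ, ContDiff ℝ (⊤ : ℕ∞) η ∧ HasCompactSupport η ∧ (∀ z, 0 ≤ η z) ∧
      (∀ z, η z ≤ 1) ∧ (∀ z ∈ s, η z = 1) ∧ (∀ z, ‖fderiv ℝ η z‖ ≤ ε) ∧
      ∀ z, ‖fderiv ℝ (fderiv ℝ η) z‖ ≤ ε := by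
  obtain ⟨f, hf, hfc, hf0, hfle, hfone⟩ : ∃ f : Cn n → ℝ, ContDiff ℝ (⊤ : ℕ∞) f ∧
      HasCompactSupport f ∧ (∀ z, 0 ≤ f z) ∧ (∀ z, f z ≤ 1) ∧
        ∀ z ∈ Metric.closedBall 0 1, f z = 1 := by
    let f : ContDiffBump (0 : Cn n) := ⟨1, 2, one_pos, one_lt_two⟩
    exact ⟨f, f.contDiff, f.hasCompactSupport, fun z => f.nonneg, fun z => f.le_one,
      fun z => f.one_of_mem_closedBall⟩
  obtain ⟨C, hC0, hC1, hC2⟩ := exists_bound_fderiv_fderiv hf hfc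
  obtain ⟨r, hr⟩ := hs.isBounded.subset_closedBall 0
  -- The cutoff is a dilated bump `f(a z)`: `a|r| ≤ 1` sends `s` into the unit ball, `aC ≤ ε`
  -- controls the first derivative, and `a ≤ 1` then controls the second, of size `a²C`.
  obtain ⟨a, ha, ha1, har, haC⟩ : ∃ a : ℝ, 0 < a ∧ a ≤ 1 ∧ a * |r| ≤ 1 ∧ a * C ≤ ε := by
    refine ⟨(1 + |r| + C / ε)⁻¹, by positivity, inv_le_one_of_one_le₀ ?_, ?_, ?_⟩
    · have : 0 ≤ |r| + C / ε := by positivity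
      linarith
    all_goals rw [inv_mul_le_iff₀ (by positivity)]
    · have : 0 ≤ C / ε := by positivity
      linarith
    · have : 0 ≤ (1 + |r|) * ε := by positivity
      have h2 : C / ε * ε = C := div_mul_cancel₀ _ hε.ne'
      linarith
  refine ⟨fun z => f (a • z), hf.comp (contDiff_const_smul a), ?_, fun z => hf0 _,
    fun z => hfle _, ?_, ?_, ?_⟩
  · exact hfc.comp_homeomorph (Homeomorph.smulOfNeZero a ha.ne')
  · intro z hz
    apply hfone
    have := hr hz
    simp only [mem_closedBall_zero_iff] at this ⊢
    rw [norm_smul, Real.norm_of_nonneg ha.le]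
    exact (mul_le_mul_of_nonneg_left (this.trans (le_abs_self r)) ha.le).trans har
  · intro z
    rw [(norm_fderiv_comp_const_smul hf ha.le z).1]
    exact (mul_le_mul_of_nonneg_left (hC1 _) ha.le).trans haC
  · intro z
    rw [(norm_fderiv_comp_const_smul hf ha.le z).2]
    have := (mul_le_mul_of_nonneg_left (hC2 (a • z)) ha.le).trans haC
    exact (mul_le_of_le_one_left (by positivity) ha1).trans this

/-- The covector is `dd^c ‖Re z‖²` at the origin; the bump only makes the function a test function.
Its multiples absorb the cutoff errors in the maximum principle. -/
theorem exists_kahler_covector (n : ℕ) :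
    ∃ ω : Covector n 2, ∀ ν : Cn n, ω ![ν, Complex.I • ν] = 2 * ‖ν‖ ^ 2 := by
  let f : ContDiffBump (0 : Cn n) := ⟨1, 2, one_pos, one_lt_two⟩
  have hq : ContDiff ℝ (⊤ : ℕ∞) fun z : Cn n => reQuadratic 0 0 1 0 (rePart z) :=
    (contDiff_reQuadratic 0 0 1 0).comp (rePartL n).contDiff
  let φ : TestFn n := toTest (fun z => f z * reQuadratic 0 0 1 0 (rePart z)) (f.contDiff.mul hq)
    f.hasCompactSupport.mul_right
  refine ⟨ddc n φ 0, fun ν => ?_⟩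
  have e : ⇑φ =ᶠ[nhds 0] fun z : Cn n => reQuadratic 0 0 1 0 (rePart z) := by
    filter_upwards [f.eventuallyEq_one] with z hz
    change f z * _ = _
    rw [hz, Pi.one_apply, one_mul]
  have e2 := e.fderiv (𝕜 := ℝ) |>.fderiv_eq (𝕜 := ℝ)
  have := levi_reQuadratic (n := n) 0 0 1 0 0 ν
  rw [ddc_apply_I, levi, e2]
  rw [levi] at this
  simpa using this

theorem covector_apply_I_le (a : Covector n 2) (ν : Cn n) :
    |a ![ν, Complex.I • ν]| ≤ ‖a‖ * ‖ν‖ ^ 2 := by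
  have := a.le_opNorm ![ν, Complex.I • ν]
  simpa [Fin.prod_univ_two, norm_smul, sq] using this

end Bochner

/-! ### The maximum principle for currents: part (2) -/

namespace Bochner

set_option maxSynthPendingDepth 3

variable {n : ℕ}

/-- By Carathéodory, the hull is the image of simplex times `K^N` with `N = dim E + 1`; shorter
combinations are padded with zero weights at `k₀`. -/
theorem isCompact_convexHull_of_finiteDimensional {E : Type*} [NormedAddCommGroup E]
    [NormedSpace ℝ E] [FiniteDimensional ℝ E] {K : Set E} (hK : IsCompact K) :
    IsCompact (convexHull ℝ K) := by
  rcases K.eq_empty_or_nonempty with rfl | ⟨k₀, hk₀⟩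
  · simp
  let N := Module.finrank ℝ E + 1
  have hc : IsCompact ((fun q : (Fin N → ℝ) × (Fin N → E) => ∑ i, q.1 i • q.2 i) ''
      (stdSimplex ℝ (Fin N) ×ˢ Set.univ.pi fun _ => K)) :=
    ((isCompact_stdSimplex ℝ (Fin N)).prod (isCompact_univ_pi fun _ => hK)).image (by fun_prop)
  convert hc using 1
  apply Set.Subset.antisymm
  · intro x hx
    obtain ⟨ι, _, z, w, hz, hind, hw, hw1, hx⟩ := eq_pos_convex_span_of_mem_convexHull hx
    have hcard : Fintype.card ι ≤ Fintype.card (Fin N) := by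
      rw [Fintype.card_fin]
      exact hind.card_le_finrank_succ.trans
        (Nat.add_le_add_right (Submodule.finrank_le _) 1)
    obtain ⟨f⟩ := Function.Embedding.nonempty_of_card_le hcard
    refine ⟨(Function.extend f w 0, Function.extend f z fun _ => k₀), ⟨⟨fun j => ?_, ?_⟩,
      fun j _ => ?_⟩, ?_⟩
    · by_cases hj : ∃ i, f i = j
      · obtain ⟨i, rfl⟩ := hj
        simpa [f.injective.extend_apply] using (hw i).le
      · simp [Function.extend_apply' _ _ _ hj]
    · rw [← hw1]
      exact (Fintype.sum_of_injective f f.injective w (Function.extend f w 0)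
        (fun j hj => Function.extend_apply' w (0 : Fin N → ℝ) j hj)
        fun i => (f.injective.extend_apply w (0 : Fin N → ℝ) i).symm).symm
    · by_cases hj : ∃ i, f i = j
      · obtain ⟨i, rfl⟩ := hj
        simpa [f.injective.extend_apply] using hz (Set.mem_range_self i)
      · simpa [Function.extend_apply' _ _ _ hj] using hk₀
    · rw [← hx]
      refine (Fintype.sum_of_injective f f.injective _ _ (fun j hj => ?_) fun i => ?_).symm
      · simp [Function.extend_apply' _ _ _ hj]
      · simp [f.injective.extend_apply]
  · rintro _ ⟨⟨w, z⟩, ⟨hw, hz⟩, rfl⟩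
    exact (convex_convexHull ℝ K).sum_mem (fun i _ => hw.1 i) hw.2
      fun i _ => subset_convexHull ℝ K (hz i trivial)

/-- Cutoff functions depending only on the real part. -/
theorem exists_rePart_cutoff (n : ℕ) {ρ : ℝ} (hρ : 0 < ρ) :
    ∃ ψ : Cn n → ℝ, ContDiff ℝ (⊤ : ℕ∞) ψ ∧ (∀ z, 0 ≤ ψ z) ∧
      (∀ z, ‖rePart z‖ < ρ → ψ z = 1) ∧ ∀ z, ρ + 1 ≤ ‖rePart z‖ → ψ z = 0 := by
  let f : ContDiffBump (0 : Rn n) := ⟨ρ, ρ + 1, hρ, lt_add_one ρ⟩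
  refine ⟨fun z => f (rePart z), f.contDiff.comp (rePartL n).contDiff, fun z => f.nonneg,
    fun z hz => f.one_of_mem_closedBall ?_, fun z hz => f.zero_of_le_dist ?_⟩
  · rw [mem_closedBall_zero_iff]; exact hz.le
  · rw [dist_zero_right]; exact hz

theorem levi_eq_zero_of_notMem_tsupport {f : Cn n → ℝ} {z : Cn n} (hz : z ∉ tsupport f)
    (ν : Cn n) : levi f z ν = 0 := by
  have : fderiv ℝ (fderiv ℝ f) z = 0 :=
    image_eq_zero_of_notMem_tsupport fun h =>
      hz (tsupport_fderiv_subset ℝ (tsupport_fderiv_subset ℝ h))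
  simp [levi, this]

theorem abs_levi_le (f : Cn n → ℝ) (z ν : Cn n) :
    |levi f z ν| ≤ 2 * ‖fderiv ℝ (fderiv ℝ f) z‖ * ‖ν‖ ^ 2 := by
  have h1 : ∀ v : Cn n, ‖v‖ = ‖ν‖ → |fderiv ℝ (fderiv ℝ f) z v v| ≤
      ‖fderiv ℝ (fderiv ℝ f) z‖ * ‖ν‖ ^ 2 := by
    intro v hv
    have := (fderiv ℝ (fderiv ℝ f) z).le_opNorm₂ v v
    rw [hv] at this
    rw [sq, ← mul_assoc]
    exact this
  have h2 := h1 ν rfl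
  have h3 := h1 (Complex.I • ν) (by simp [norm_smul])
  rw [levi]
  refine (abs_add_le _ _).trans ?_
  linarith

/-- Lower bound for the Levi form of a product with a cutoff function. -/
theorem le_levi_mul_cutoff {u η : Cn n → ℝ} (hu : ContDiff ℝ 2 u) (hη : ContDiff ℝ 2 η)
    {z : Cn n} {M ε : ℝ} (hM : |u z| ≤ M) (hM' : ‖fderiv ℝ u z‖ ≤ M)
    (h1 : ‖fderiv ℝ η z‖ ≤ ε) (h2 : ‖fderiv ℝ (fderiv ℝ η) z‖ ≤ ε) (ν : Cn n) :
    η z * levi u z ν - 6 * M * ε * ‖ν‖ ^ 2 ≤ levi (fun y => u y * η y) z ν := by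
  have hM0 : 0 ≤ M := (abs_nonneg _).trans hM
  have hε0 : 0 ≤ ε := (norm_nonneg _).trans h1
  have hp : ∀ v : Cn n, ‖v‖ = ‖ν‖ → |fderiv ℝ u z v * fderiv ℝ η z v| ≤ M * ε * ‖ν‖ ^ 2 := by
    intro v hv
    rw [abs_mul]
    have a1 := ((fderiv ℝ u z).le_opNorm v).trans (mul_le_mul_of_nonneg_right hM' (norm_nonneg v))
    have a2 := ((fderiv ℝ η z).le_opNorm v).trans (mul_le_mul_of_nonneg_right h1 (norm_nonneg v))
    rw [hv] at a1 a2
    calc _ ≤ (M * ‖ν‖) * (ε * ‖ν‖) := mul_le_mul a1 a2 (abs_nonneg _) (by positivity)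
      _ = _ := by ring
  have b1 := (abs_le.1 (hp ν rfl)).1
  have b2 := (abs_le.1 (hp (Complex.I • ν) (by simp [norm_smul]))).1
  have b3 : |u z * levi η z ν| ≤ M * (2 * ε * ‖ν‖ ^ 2) := by
    rw [abs_mul]
    refine mul_le_mul hM ((abs_levi_le η z ν).trans ?_) (abs_nonneg _) hM0
    gcongr
  have b4 := (abs_le.1 b3).1
  -- The constant `6` is `2` from `u · levi η` plus `2 · 2` from the two cross terms.
  rw [levi_mul hu hη]
  linarith

/-- The estimate behind the maximum principle: a current of finite mass with nonpositive `dd^c`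
off a set does not charge the region where a plurisubharmonic function of the real part,
vanishing near that set, is strictly plurisubharmonic. -/
theorem apply_nonpos_of_strictly_psh {T : Current n} (hT : IsPositiveCurrent T)
    (hm : mass T < ⊤) {ρ : ℝ} (hρ : 0 < ρ) (hTρ : dsupport T ⊆ {z | ‖rePart z‖ < ρ})
    {Ω : Set (Cn n)} (hΩ : IsNonposOn (ddcCurrent T) Ω) {U : Rn n → ℝ}
    (hU : ContDiff ℝ (⊤ : ℕ∞) U) (hU0 : ∀ x, 0 ≤ U x)
    (hUΩ : tsupport (fun z : Cn n => U (rePart z)) ⊆ Ω)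
    (hlevi : ∀ z ν, 0 ≤ levi (fun z : Cn n => U (rePart z)) z ν) (β : TestForm n 2) {m : ℝ}
    (hm0 : 0 < m)
    (hstrict : ∀ z ∈ tsupport β, ∀ ν, m * ‖ν‖ ^ 2 ≤ levi (fun z : Cn n => U (rePart z)) z ν) :
    T β ≤ 0 := by
  obtain ⟨ψ, hψ, hψ0, hψ1, hψρ⟩ := exists_rePart_cutoff n hρ
  obtain ⟨ω, hω⟩ := exists_kahler_covector n
  obtain ⟨B, hB⟩ := β.continuous.bounded_above_of_compact_support β.hasCompactSupport
  have hB0 : 0 ≤ B := (norm_nonneg _).trans (hB 0)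
  set u : Cn n → ℝ := fun z => U (rePart z) with hu_def
  have hu : ContDiff ℝ (⊤ : ℕ∞) u := hU.comp (rePartL n).contDiff
  have hu2 : ContDiff ℝ 2 u := hu.of_le (WithTop.coe_le_coe.2 le_top)
  -- The strip is unbounded, but `u` depends only on the real part, so compactness of a ball in `ℝⁿ`
  -- suffices.
  obtain ⟨M, hM0, hM⟩ : ∃ M, 0 ≤ M ∧ ∀ z, ‖rePart z‖ ≤ ρ + 1 → |u z| ≤ M ∧ ‖fderiv ℝ u z‖ ≤ M := by
    obtain ⟨M1, h1⟩ := (isCompact_closedBall (0 : Rn n) (ρ + 1)).exists_bound_of_continuousOn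
      hU.continuous.continuousOn
    obtain ⟨M2, h2⟩ := (isCompact_closedBall (0 : Rn n) (ρ + 1)).exists_bound_of_continuousOn
      (hU.continuous_fderiv (by simp)).continuousOn
    refine ⟨max (|M1|) (|M2| * ‖rePartL n‖), le_max_of_le_left (abs_nonneg _), fun z hz => ?_⟩
    have hz' : rePart z ∈ Metric.closedBall (0 : Rn n) (ρ + 1) := mem_closedBall_zero_iff.2 hz
    refine ⟨le_max_of_le_left ((h1 _ hz').trans (le_abs_self _)), le_max_of_le_right ?_⟩
    have hd : HasFDerivAt u (fderiv ℝ U (rePart z) ∘L rePartL n) z :=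
      ((hU.differentiable (by simp)) (rePart z)).hasFDerivAt.comp z (rePartL n).hasFDerivAt
    rw [hd.fderiv]
    refine (ContinuousLinearMap.opNorm_comp_le _ _).trans ?_
    exact mul_le_mul_of_nonneg_right ((h2 _ hz').trans (le_abs_self _)) (norm_nonneg _)
  -- With this constant `C · levi u` dominates `β` on the support of `β`.
  set C := B / m with hC
  have hC0 : 0 ≤ C := div_nonneg hB0 hm0.le
  have key : ∀ ε : ℝ, 0 < ε → T β ≤ ε * (3 * M * C * ((mass T).toReal * ‖ω‖)) := by
    intro ε hε
    obtain ⟨η, hη, hηc, hη0, hη1, hηβ, hηd, hηdd⟩ := exists_cutoff β.hasCompactSupport hε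
    -- `θ` only makes the constant covector `ω` a test form equal to `ω` on the support of `η`; its
    -- derivative bounds play no role.
    obtain ⟨θ, hθ, hθc, hθ0, hθ1, hθη, -, -⟩ := exists_cutoff hηc one_pos
    have hη2 : ContDiff ℝ 2 η := hη.of_le (WithTop.coe_le_coe.2 le_top)
    let φ : TestFn n := toTest (fun z => u z * η z) (hu.mul hη) hηc.mul_left
    let W : TestForm n 2 := toTest (fun z => θ z • ω) (hθ.smul contDiff_const) hθc.smul_right
    -- Since `ω` takes the value `2‖ν‖²`, the last term cancels the cutoff error `6MCε‖ν‖²`. Hence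
    -- `γ` is positive over the ball of radius `ρ + 1`, and expanding `0 ≤ T γ` bounds `T β` by a
    -- multiple of `ε`.
    let γ : TestForm n 2 := C • ddc n φ - β + (3 * M * C * ε) • W
    have h1 : T (ddc n φ) ≤ 0 := by
      refine hΩ φ ?_ fun z => mul_nonneg (hU0 _) (hη0 z)
      exact (tsupport_mul_subset_left (f := u) (g := η)).trans hUΩ
    have h2 : T W ≤ (mass T).toReal * ‖ω‖ := by
      refine apply_le_of_mass hm W fun z => ?_
      change ‖θ z • ω‖ ≤ _
      rw [norm_smul, Real.norm_of_nonneg (hθ0 z)]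
      exact mul_le_of_le_one_left (norm_nonneg _) (hθ1 z)
    have h3 : 0 ≤ T γ := by
      -- The bounds by `M` hold only over that ball; multiplying by `ψ`, which is `1` near the
      -- support of `T`, discards the rest.
      rw [← apply_smulForm_eq T γ ψ hψ
        (isOpen_lt (continuous_norm.comp continuous_rePart) continuous_const) hTρ hψ1]
      refine hT.nonneg_of_isPositiveForm _ fun z ν => ?_
      rw [smulForm_apply, ContinuousAlternatingMap.smul_apply, smul_eq_mul]
      rcases le_or_gt (ρ + 1) ‖rePart z‖ with hz | hz
      · rw [hψρ z hz, zero_mul]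
      refine mul_nonneg (hψ0 z) ?_
      have e : γ z ![ν, Complex.I • ν] = C * levi (fun y => u y * η y) z ν -
          β z ![ν, Complex.I • ν] + 3 * M * C * ε * (θ z * (2 * ‖ν‖ ^ 2)) := by
        rw [← hω ν]
        have := ddc_apply_I φ z ν
        change C * (ddc n φ z ![ν, Complex.I • ν]) - _ + 3 * M * C * ε * (θ z * _) = _
        rw [this]
        rfl
      rw [e]
      have hb : β z ![ν, Complex.I • ν] ≤ C * (η z * levi u z ν) := by
        by_cases hzβ : z ∈ tsupport β
        · rw [hηβ z hzβ, one_mul]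
          refine (le_abs_self _).trans ((covector_apply_I_le _ ν).trans ?_)
          calc ‖β z‖ * ‖ν‖ ^ 2 ≤ B * ‖ν‖ ^ 2 := by gcongr; exact hB z
            _ = C * (m * ‖ν‖ ^ 2) := by rw [hC]; field_simp
            _ ≤ _ := mul_le_mul_of_nonneg_left (hstrict z hzβ ν) hC0
        · rw [image_eq_zero_of_notMem_tsupport hzβ]
          exact mul_nonneg hC0 (mul_nonneg (hη0 z) (hlevi z ν))
      by_cases hzη : z ∈ tsupport η
      · rw [hθη z hzη]
        have := mul_le_mul_of_nonneg_left (le_levi_mul_cutoff hu2 hη2 (hM z hz.le).1 (hM z hz.le).2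
          (hηd z) (hηdd z) ν) hC0
        linarith
      · have h0 : levi (fun y => u y * η y) z ν = 0 :=
          levi_eq_zero_of_notMem_tsupport (fun h => hzη (tsupport_mul_subset_right h)) ν
        rw [image_eq_zero_of_notMem_tsupport hzη, zero_mul, mul_zero] at hb
        rw [h0]
        have : 0 ≤ 3 * M * C * ε * (θ z * (2 * ‖ν‖ ^ 2)) := by
          have := hθ0 z
          positivity
        linarith
    have h4 : T γ = C * T (ddc n φ) - T β + 3 * M * C * ε * T W := by
      simp only [γ, map_add, map_sub, map_smul, smul_eq_mul]
    have h5 : C * T (ddc n φ) ≤ 0 := mul_nonpos_of_nonneg_of_nonpos hC0 h1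
    have h6 : 3 * M * C * ε * T W ≤ 3 * M * C * ε * ((mass T).toReal * ‖ω‖) :=
      mul_le_mul_of_nonneg_left h2 (by positivity)
    linarith
  set A := 3 * M * C * ((mass T).toReal * ‖ω‖) with hA
  have hA0 : 0 ≤ A := by
    have : 0 ≤ (mass T).toReal := ENNReal.toReal_nonneg
    positivity
  refine le_of_forall_pos_le_add fun ε hε => ?_
  refine (key (ε / (A + 1)) (by positivity)).trans ?_
  rw [zero_add, div_mul_eq_mul_div, div_le_iff₀ (by positivity)]
  nlinarith

theorem dsupport_subset_tube_convexHull {K : Set (Rn n)} (hK : IsCompact K) {T : Current n}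
    (hT : IsPositiveCurrent T) (hm : mass T < ⊤)
    (hb : Bornology.IsBounded (rePart '' dsupport T))
    (hΩ : IsNonposOn (ddcCurrent T) (tube K)ᶜ) : dsupport T ⊆ tube (convexHull ℝ K) := by
  intro z₀ hz₀
  by_contra hp
  set p := rePart z₀ with hp_def
  change p ∉ convexHull ℝ K at hp
  obtain ⟨ℓ, c, hℓK, hℓp⟩ := geometric_hahn_banach_closed_point (convex_convexHull ℝ K)
    (isCompact_convexHull_of_finiteDimensional hK).isClosed hp
  obtain ⟨e, he⟩ := (InnerProductSpace.toDual ℝ (Rn n)).surjective ℓ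
  have heℓ : ∀ x, inner ℝ e x = ℓ x := fun x => by rw [← he]; simp
  obtain ⟨c', hcc', hc'p⟩ := exists_between hℓp
  obtain ⟨r, hr⟩ := (hK.image (continuous_id.sub continuous_const : Continuous fun x => x - p)
    |>.isBounded).exists_norm_le
  -- On `K` the quadratic term is at most `δr²`, which fits into the gap between `c` and `c'`, so
  -- `q` stays negative there.
  obtain ⟨δ, hδ, hδr⟩ : ∃ δ : ℝ, 0 < δ ∧ δ * r ^ 2 ≤ c' - c := by
    refine ⟨(c' - c) / (r ^ 2 + 1), div_pos (by linarith) (by positivity), ?_⟩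
    rw [div_mul_eq_mul_div, div_le_iff₀ (by positivity)]
    nlinarith
  have hneg : ∀ x ∈ K, reQuadratic e c' δ p x < 0 := by
    intro x hx
    have h1 := hℓK x (subset_convexHull ℝ K hx)
    have h2 : ‖x - p‖ ^ 2 ≤ r ^ 2 :=
      pow_le_pow_left₀ (norm_nonneg _) (hr _ (Set.mem_image_of_mem _ hx)) 2
    have h3 := mul_le_mul_of_nonneg_left h2 hδ.le
    rw [reQuadratic, heℓ]
    linarith
  have hpos : 0 < reQuadratic e c' δ p p := by
    rw [reQuadratic, heℓ]
    simpa using hc'p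
  obtain ⟨χ, hχ, hχ0, hχn, hχ', hχ'', hχp⟩ := exists_smooth_convex_vanishing
  have hq : ContDiff ℝ (⊤ : ℕ∞) (reQuadratic e c' δ p) := contDiff_reQuadratic e c' δ p
  have hlevi : ∀ z ν : Cn n, deriv χ (reQuadratic e c' δ p (rePart z)) * (2 * δ * ‖ν‖ ^ 2) ≤
      levi (fun z : Cn n => χ (reQuadratic e c' δ p (rePart z))) z ν := by
    intro z ν
    rw [levi_comp_real (h := fun z : Cn n => reQuadratic e c' δ p (rePart z))
      (hχ.of_le (WithTop.coe_le_coe.2 le_top))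
      ((contDiff_reQuadratic e c' δ p).comp (rePartL n).contDiff), levi_reQuadratic]
    have := hχ'' (reQuadratic e c' δ p (rePart z))
    exact le_add_of_nonneg_left (by positivity)
  obtain ⟨ρ, hρ⟩ := hb.exists_norm_le
  have hcont : Continuous fun z : Cn n => reQuadratic e c' δ p (rePart z) :=
    hq.continuous.comp continuous_rePart
  have main : ∀ β : TestForm n 2, tsupport β ⊆ {z | 0 < reQuadratic e c' δ p (rePart z)} →
      T β ≤ 0 := by
    intro β hβ
    -- On the compact support of `β`, `χ'(q)` has a positive lower bound `m`, so the Levi form is at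
    -- least `2δm‖ν‖²` there.
    obtain ⟨m, hm0, hmβ⟩ := IsCompact.exists_forall_le' (a := 0) β.hasCompactSupport
      (f := fun z => deriv χ (reQuadratic e c' δ p (rePart z)))
      ((hχ.continuous_deriv (by simp)).comp hcont).continuousOn (fun z hz => hχp _ (hβ hz))
    refine apply_nonpos_of_strictly_psh hT hm (ρ := |ρ| + 1) (by positivity)
      (fun z hz => ?_) hΩ (hχ.comp hq) (fun x => hχn _) ?_ ?_ β (m := m * (2 * δ))
      (by positivity) ?_
    · exact ((hρ _ (Set.mem_image_of_mem _ hz)).trans (le_abs_self ρ)).trans_lt (lt_add_one _)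
    · have hcl : IsClosed {z : Cn n | 0 ≤ reQuadratic e c' δ p (rePart z)} :=
        isClosed_le continuous_const hcont
      refine (closure_minimal (fun z hz => ?_) hcl).trans fun z hz hzK => ?_
      · by_contra hlt
        exact hz (hχ0 _ (not_le.1 hlt).le)
      · exact (hneg _ hzK).not_ge hz
    · intro z ν
      have := hχ' (reQuadratic e c' δ p (rePart z))
      exact le_trans (by positivity) (hlevi z ν)
    · intro z hz ν
      refine le_trans ?_ (hlevi z ν)
      rw [mul_assoc]
      exact mul_le_mul_of_nonneg_right (hmβ z hz) (by positivity)
  -- `main` assumes no sign of `β`; applied to `β` and `-β` it shows that `T` vanishes on the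
  -- neighbourhood `{q > 0}` of `z₀`.
  refine (notMem_dsupport_iff (f := T) z₀).2 ⟨{z | 0 < reQuadratic e c' δ p (rePart z)},
    fun β hβ => le_antisymm (main β hβ) ?_, isOpen_lt continuous_const hcont, hpos⟩ hz₀
  have h := main (-β) (by
    have : ⇑(-β) = -⇑β := rfl
    rw [this, tsupport, Function.support_neg]
    exact hβ)
  rw [map_neg] at h
  linarith

end Bochner

/-! ### Green's formula on the disc, with `log(1/s) ds` as the law of `s = r x` for uniform `r`, `x`
-/

namespace Bochner

set_option maxSynthPendingDepth 3

/-- Lebesgue measure on the box `(0, 2π] × (0, 1] × (0, 1]`. -/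
def boxMeasure : Measure (ℝ × ℝ × ℝ) :=
  (volume.restrict (Set.Ioc 0 (2 * Real.pi))).prod
    ((volume.restrict (Set.Ioc 0 1)).prod (volume.restrict (Set.Ioc 0 1)))

theorem boxMeasure_eq : boxMeasure = (volume : Measure (ℝ × ℝ × ℝ)).restrict
    (Set.Ioc 0 (2 * Real.pi) ×ˢ Set.Ioc 0 1 ×ˢ Set.Ioc 0 1) := by
  rw [boxMeasure, Measure.prod_restrict, Measure.prod_restrict]
  rfl

theorem integrable_boxMeasure {F : ℝ × ℝ × ℝ → ℝ} (hF : Continuous F) :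
    Integrable F boxMeasure := by
  rw [boxMeasure_eq]
  have hc : IsCompact (Set.Icc 0 (2 * Real.pi) ×ˢ Set.Icc (0 : ℝ) 1 ×ˢ Set.Icc (0 : ℝ) 1) :=
    isCompact_Icc.prod (isCompact_Icc.prod isCompact_Icc)
  exact (hF.continuousOn.integrableOn_compact hc).mono_set
    (Set.prod_mono Set.Ioc_subset_Icc_self
      (Set.prod_mono Set.Ioc_subset_Icc_self Set.Ioc_subset_Icc_self))

theorem boxMeasure_ae_nonneg : ∀ᵐ p ∂boxMeasure, 0 ≤ p.2.1 * p.2.2 ∧ p.2.1 * p.2.2 ≤ 1 := by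
  rw [boxMeasure_eq]
  refine (ae_restrict_mem (measurableSet_Ioc.prod (measurableSet_Ioc.prod measurableSet_Ioc))).mono
    fun p hp => ?_
  obtain ⟨-, h1, h2⟩ := hp
  exact ⟨mul_nonneg h1.1.le h2.1.le, mul_le_one₀ h1.2 h2.1.le h2.2⟩

/-- The point `r x e^{iθ}` of the unit disc. -/
def diskPt (p : ℝ × ℝ × ℝ) : ℂ := (p.2.1 * p.2.2) • circleMap 0 1 p.1

theorem continuous_diskPt : Continuous diskPt := by
  unfold diskPt
  fun_prop

section Green

variable {v : ℂ → ℝ}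

/-- Rotation invariance of the trace: it allows the Laplacian to be split into radial and angular
directions. -/
theorem levi_one_eq_of_norm_eq_one (v : ℂ → ℝ) (z : ℂ) {e : ℂ} (he : ‖e‖ = 1) :
    levi v z 1 = fderiv ℝ (fderiv ℝ v) z e e +
      fderiv ℝ (fderiv ℝ v) z (e * Complex.I) (e * Complex.I) := by
  have h1 : e = e.re • (1 : ℂ) + e.im • Complex.I := by
    apply Complex.ext <;> simp
  have h2 : e * Complex.I = (-e.im) • (1 : ℂ) + e.re • Complex.I := by
    apply Complex.ext <;> simp
  have h3 : e.re * e.re + e.im * e.im = 1 := by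
    rw [← Complex.normSq_apply, Complex.normSq_eq_norm_sq, he]; norm_num
  set L := fderiv ℝ (fderiv ℝ v) z with hL
  have h4 : levi v z 1 = L 1 1 + L Complex.I Complex.I := by simp [levi, hL]
  have hee : ∀ a b : ℝ, L (a • (1 : ℂ) + b • Complex.I) (a • (1 : ℂ) + b • Complex.I) =
      a * a * L 1 1 + a * b * L 1 Complex.I + b * a * L Complex.I 1 +
        b * b * L Complex.I Complex.I := by
    intro a b
    simp only [map_add, map_smul, add_apply, smul_apply, smul_eq_mul]
    ring
  have h5 := hee e.re e.im
  rw [← h1] at h5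
  rw [h4, h5, h2, hee]
  linear_combination -(L 1 1 + L Complex.I Complex.I) * h3

theorem hasDerivAt_along_ray (hv : ContDiff ℝ 2 v) (e : ℂ) (r : ℝ) :
    HasDerivAt (fun r : ℝ => v (r • e)) (fderiv ℝ v (r • e) e) r := by
  have h1 : HasDerivAt (fun r : ℝ => r • e) e r := by
    simpa using (hasDerivAt_id r).smul_const e
  exact ((hv.differentiable (by norm_num)) (r • e)).hasFDerivAt.comp_hasDerivAt r h1

/-- The integrand is the `x`-derivative of `x · Dv(r x e) e`, and the resulting `Dv(r e) e` is the
`r`-derivative of `v(r e)`. -/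
theorem integral_ray_eq (hv : ContDiff ℝ 2 v) (e : ℂ) :
    ∫ r in (0 : ℝ)..1, ∫ x in (0 : ℝ)..1, (fderiv ℝ v ((r * x) • e) e +
      r * x * fderiv ℝ (fderiv ℝ v) ((r * x) • e) e e) = v e - v 0 := by
  have hc1 : Continuous (fderiv ℝ v) := hv.continuous_fderiv (by norm_num)
  have hv1 : ContDiff ℝ 1 (fderiv ℝ v) := hv.fderiv_right (by norm_num)
  have hc2 : Continuous (fderiv ℝ (fderiv ℝ v)) := hv1.continuous_fderiv (by norm_num)
  have inner : ∀ r : ℝ, ∫ x in (0 : ℝ)..1, (fderiv ℝ v ((r * x) • e) e +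
      r * x * fderiv ℝ (fderiv ℝ v) ((r * x) • e) e e) = fderiv ℝ v (r • e) e := by
    intro r
    have hd : ∀ x : ℝ, HasDerivAt (fun x : ℝ => x * fderiv ℝ v ((r * x) • e) e)
        (fderiv ℝ v ((r * x) • e) e + r * x * fderiv ℝ (fderiv ℝ v) ((r * x) • e) e e) x := by
      intro x
      have h1 : HasDerivAt (fun x : ℝ => (r * x) • e) (r • e) x := by
        simpa using ((hasDerivAt_id x).const_mul r).smul_const e
      have h2 := ((hv1.differentiable (by norm_num)) ((r * x) • e)).hasFDerivAt.comp_hasDerivAt x h1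
      have h3 := (hasDerivAt_id x).mul (h2.clm_apply (hasDerivAt_const x e))
      refine h3.congr_deriv ?_
      simp only [map_smul, smul_apply, smul_eq_mul, Function.comp_apply, map_zero, add_zero,
        one_mul, id]
      ring
    rw [intervalIntegral.integral_eq_sub_of_hasDerivAt (fun x _ => hd x)]
    · simp
    · apply Continuous.intervalIntegrable
      fun_prop
  simp only [inner]
  rw [intervalIntegral.integral_eq_sub_of_hasDerivAt
    (fun r _ => hasDerivAt_along_ray hv e r)]
  · simp
  · apply Continuous.intervalIntegrable
    fun_prop

/-- Green's formula on the unit disc. -/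
theorem integral_levi_disk (hv : ContDiff ℝ 2 v) :
    ∫ p, p.2.1 * p.2.2 * levi v (diskPt p) 1 ∂boxMeasure =
      (∫ θ in (0 : ℝ)..2 * Real.pi, v (circleMap 0 1 θ)) - 2 * Real.pi * v 0 := by
  have hc1 : Continuous (fderiv ℝ v) := hv.continuous_fderiv (by norm_num)
  have hv1 : ContDiff ℝ 1 (fderiv ℝ v) := hv.fderiv_right (by norm_num)
  have hc2 : Continuous (fderiv ℝ (fderiv ℝ v)) := hv1.continuous_fderiv (by norm_num)
  have hcm : Continuous (circleMap 0 1) := continuous_circleMap 0 1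
  set e : ℝ → ℂ := circleMap 0 1 with he
  have hpi : (0 : ℝ) ≤ 2 * Real.pi := by positivity
  -- `Dv(e)` is added to the radial part and subtracted from the angular part. Then `G` integrates
  -- along rays to `v(e) - v(0)`, while `H` is the `θ`-derivative of `Dv(r x e)(ie)` and integrates
  -- to zero by periodicity.
  let G : ℝ × ℝ × ℝ → ℝ := fun p => fderiv ℝ v ((p.2.1 * p.2.2) • e p.1) (e p.1) +
    p.2.1 * p.2.2 * fderiv ℝ (fderiv ℝ v) ((p.2.1 * p.2.2) • e p.1) (e p.1) (e p.1)
  let H : ℝ × ℝ × ℝ → ℝ := fun p =>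
    p.2.1 * p.2.2 * fderiv ℝ (fderiv ℝ v) ((p.2.1 * p.2.2) • e p.1) (e p.1 * Complex.I)
      (e p.1 * Complex.I) - fderiv ℝ v ((p.2.1 * p.2.2) • e p.1) (e p.1)
  have hG : Continuous G := by fun_prop
  have hH : Continuous H := by fun_prop
  have hsum : ∀ p, p.2.1 * p.2.2 * levi v (diskPt p) 1 = G p + H p := by
    intro p
    have hn : ‖e p.1‖ = 1 := by simp [he]
    rw [levi_one_eq_of_norm_eq_one v _ hn]
    simp only [G, H, diskPt, ← he]
    ring
  have hGi := integrable_boxMeasure hG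
  have hHi := integrable_boxMeasure hH
  simp only [hsum]
  rw [integral_add hGi hHi]
  have h1 : ∫ p, G p ∂boxMeasure = ∫ θ in (0 : ℝ)..2 * Real.pi, (v (e θ) - v 0) := by
    rw [boxMeasure, integral_prod _ hGi, intervalIntegral.integral_of_le hpi]
    refine integral_congr_ae (hGi.prod_right_ae.mono fun θ hθ => ?_)
    change ∫ q, G (θ, q) ∂_ = v (e θ) - v 0
    rw [integral_prod _ hθ, ← integral_ray_eq hv (e θ),
      intervalIntegral.integral_of_le zero_le_one]
    simp only [intervalIntegral.integral_of_le zero_le_one, G]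
  have h2 : ∫ p, H p ∂boxMeasure = 0 := by
    rw [boxMeasure, integral_prod_symm _ hHi]
    refine integral_eq_zero_of_ae (Filter.Eventually.of_forall fun q => ?_)
    change ∫ θ in Set.Ioc 0 (2 * Real.pi), H (θ, q) = 0
    rw [← intervalIntegral.integral_of_le hpi]
    have hd : ∀ θ : ℝ, HasDerivAt
        (fun θ => fderiv ℝ v ((q.1 * q.2) • e θ) (e θ * Complex.I)) (H (θ, q)) θ := by
      intro θ
      have h0 : HasDerivAt e (e θ * Complex.I) θ := hasDerivAt_circleMap 0 1 θ
      have h1 := h0.const_smul (q.1 * q.2)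
      have h2 := ((hv1.differentiable (by norm_num))
        ((q.1 * q.2) • e θ)).hasFDerivAt.comp_hasDerivAt θ h1
      have h3 := h2.clm_apply (h0.mul_const Complex.I)
      refine h3.congr_deriv ?_
      have h4 : e θ * Complex.I * Complex.I = -e θ := by
        rw [mul_assoc, Complex.I_mul_I, mul_neg_one]
      rw [h4]
      simp only [H, map_smul, smul_apply, smul_eq_mul, map_neg, Function.comp_apply,
        Pi.smul_apply]
      ring
    rw [intervalIntegral.integral_eq_sub_of_hasDerivAt (fun θ _ => hd θ)]
    · simp [he, circleMap]
    · apply Continuous.intervalIntegrable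
      exact hH.comp (by fun_prop)
  rw [h1, h2, add_zero, intervalIntegral.integral_sub]
  · simp
  · exact ((hv.continuous.comp hcm).intervalIntegrable _ _)
  · exact intervalIntegrable_const

end Green

end Bochner

/-! ### Integration over holomorphic discs -/

namespace Bochner

set_option maxSynthPendingDepth 3

variable {n : ℕ} {f : ℂ → Cn n}

/-- The integral of a `2`-form over the disc `f` against the Green function of the unit disc. -/
def discIntegral (f : ℂ → Cn n) (α : TestForm n 2) : ℝ :=
  (2 * Real.pi)⁻¹ * ∫ p, p.2.1 * p.2.2 * α (f (diskPt p))
    ![deriv f (diskPt p), Complex.I • deriv f (diskPt p)] ∂boxMeasure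

theorem continuous_discIntegrand (hf : ContDiff ℂ 2 f) (α : TestForm n 2) :
    Continuous fun p : ℝ × ℝ × ℝ => p.2.1 * p.2.2 * α (f (diskPt p))
      ![deriv f (diskPt p), Complex.I • deriv f (diskPt p)] := by
  have h1 : Continuous fun p : ℝ × ℝ × ℝ => α (f (diskPt p)) :=
    α.continuous.comp (hf.continuous.comp continuous_diskPt)
  have h2 : Continuous fun p => deriv f (diskPt p) :=
    (hf.continuous_deriv (by norm_num)).comp continuous_diskPt
  have h3 : Continuous fun p => ![deriv f (diskPt p), Complex.I • deriv f (diskPt p)] := by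
    refine continuous_pi fun i => ?_
    fin_cases i
    · exact h2
    · exact h2.const_smul Complex.I
  have h4 : Continuous fun p : ℝ × ℝ × ℝ => α (f (diskPt p))
      ![deriv f (diskPt p), Complex.I • deriv f (diskPt p)] :=
    ((ContinuousAlternatingMap.toContinuousMultilinearMapCLM ℝ).continuous.comp h1).eval h3
  exact (by fun_prop : Continuous fun p : ℝ × ℝ × ℝ => p.2.1 * p.2.2).mul h4

theorem discIntegral_add (hf : ContDiff ℂ 2 f) (α β : TestForm n 2) :
    discIntegral f (α + β) = discIntegral f α + discIntegral f β := by
  rw [discIntegral, discIntegral, discIntegral, ← mul_add,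
    ← integral_add (integrable_boxMeasure (continuous_discIntegrand hf α))
      (integrable_boxMeasure (continuous_discIntegrand hf β))]
  congr 2
  funext p
  rw [← mul_add]
  rfl

theorem discIntegral_smul (c : ℝ) (α : TestForm n 2) :
    discIntegral f (c • α) = c * discIntegral f α := by
  rw [discIntegral, discIntegral, mul_left_comm c, ← integral_const_mul c]
  congr 2
  funext p
  rw [mul_left_comm c]
  rfl

theorem discIntegral_nonneg {α : TestForm n 2} (hα : IsPositiveForm α) :
    0 ≤ discIntegral f α :=
  mul_nonneg (by positivity) (integral_nonneg_of_ae
    (boxMeasure_ae_nonneg.mono fun _ hp => mul_nonneg hp.1 (hα _ _)))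

theorem discIntegral_eq_zero_of_isTypeTwoZeroZeroTwo {α : TestForm n 2}
    (hα : IsTypeTwoZeroZeroTwo α) : discIntegral f α = 0 := by
  have h : ∀ z v, α z ![v, Complex.I • v] = 0 := by
    intro z v
    have h1 := hα z v (Complex.I • v)
    rw [I_smul_I_smul, covector_neg_right, covector_swap] at h1
    linarith
  simp [discIntegral, h]

theorem discIntegral_eq_zero_of_disjoint {α : TestForm n 2}
    (h : ∀ ζ : ℂ, ‖ζ‖ ≤ 1 → f ζ ∉ tsupport α) : discIntegral f α = 0 := by
  rw [discIntegral, integral_eq_zero_of_ae, mul_zero]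
  refine boxMeasure_ae_nonneg.mono fun p hp => ?_
  have h1 : ‖diskPt p‖ ≤ 1 := by
    rw [diskPt, norm_smul, Real.norm_of_nonneg hp.1]
    simpa using hp.2
  simp [image_eq_zero_of_notMem_tsupport (h _ h1)]

theorem integral_levi_comp_disk (hf : ContDiff ℂ 2 f) {u : Cn n → ℝ} (hu : ContDiff ℝ 2 u) :
    (2 * Real.pi)⁻¹ * ∫ p, p.2.1 * p.2.2 * levi u (f (diskPt p)) (deriv f (diskPt p))
      ∂boxMeasure = Real.circleAverage (fun w => u (f w)) 0 1 - u (f 0) := by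
  have h := integral_levi_disk (v := fun w => u (f w)) (hu.comp (hf.restrict_scalars ℝ))
  simp only [levi_comp_holomorphic hu hf] at h
  rw [h, Real.circleAverage_def, mul_sub, smul_eq_mul, inv_mul_cancel_left₀ (by positivity)]

theorem discIntegral_ddc (hf : ContDiff ℂ 2 f) (φ : TestFn n) :
    discIntegral f (ddc n φ) = Real.circleAverage (fun w => φ (f w)) 0 1 - φ (f 0) := by
  rw [← integral_levi_comp_disk hf (φ.contDiff.of_le (WithTop.coe_le_coe.2 le_top))]
  simp only [discIntegral, ddc_apply_I]

/-- The area of the disc `f` with respect to the Green function. -/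
theorem integral_norm_deriv_sq (hf : ContDiff ℂ 2 f) :
    (2 * Real.pi)⁻¹ * ∫ p, p.2.1 * p.2.2 * (2 * ‖deriv f (diskPt p)‖ ^ 2) ∂boxMeasure =
      Real.circleAverage (fun w => ‖rePart (f w)‖ ^ 2) 0 1 - ‖rePart (f 0)‖ ^ 2 := by
  have h := integral_levi_comp_disk hf (u := fun z => reQuadratic 0 0 1 0 (rePart z))
    ((contDiff_reQuadratic 0 0 1 0).comp (rePartL n).contDiff)
  simp only [levi_reQuadratic] at h
  simpa [reQuadratic] using h

theorem circleAverage_norm_rePart_sq_le {R : ℝ}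
    (hR : ∀ w : ℂ, ‖w‖ = 1 → ‖rePart (f w)‖ ≤ R) (hf : ContDiff ℂ 2 f) :
    Real.circleAverage (fun w => ‖rePart (f w)‖ ^ 2) 0 1 ≤ R ^ 2 := by
  have hc : Continuous fun w => ‖rePart (f w)‖ ^ 2 :=
    ((continuous_rePart.comp hf.continuous).norm).pow 2
  refine Real.circleAverage_mono_on_of_le_circle hc.continuousOn.circleIntegrable'
    fun w hw => ?_
  refine pow_le_pow_left₀ (norm_nonneg _) (hR w ?_) 2
  simpa using hw

/-- The Green-weighted area is computed by Green's formula for `‖Re z‖²`, so boundary real parts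
bound the mass even though imaginary parts are uncontrolled. -/
theorem abs_discIntegral_le (hf : ContDiff ℂ 2 f) {R : ℝ}
    (hR : ∀ w : ℂ, ‖w‖ = 1 → ‖rePart (f w)‖ ≤ R) (α : TestForm n 2) {c : ℝ}
    (hα : ∀ z, ‖α z‖ ≤ c) : |discIntegral f α| ≤ R ^ 2 * c := by
  have hc0 : 0 ≤ c := (norm_nonneg _).trans (hα 0)
  have hE := integral_norm_deriv_sq hf
  have hd : Continuous fun p => ‖deriv f (diskPt p)‖ :=
    ((hf.continuous_deriv (by norm_num)).comp continuous_diskPt).norm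
  have hb : |∫ p, p.2.1 * p.2.2 * α (f (diskPt p))
      ![deriv f (diskPt p), Complex.I • deriv f (diskPt p)] ∂boxMeasure| ≤
      ∫ p, c * (p.2.1 * p.2.2 * (2 * ‖deriv f (diskPt p)‖ ^ 2)) ∂boxMeasure := by
    refine (abs_integral_le_integral_abs).trans (integral_mono_ae
      (integrable_boxMeasure (continuous_discIntegrand hf α)).abs
      (integrable_boxMeasure (by fun_prop)) (boxMeasure_ae_nonneg.mono fun p hp => ?_))
    change |p.2.1 * p.2.2 * _| ≤ c * (p.2.1 * p.2.2 * (2 * ‖deriv f (diskPt p)‖ ^ 2))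
    rw [abs_mul, abs_of_nonneg hp.1, mul_left_comm]
    refine mul_le_mul_of_nonneg_left ?_ hp.1
    refine (covector_apply_I_le _ _).trans ?_
    have := mul_le_mul_of_nonneg_right (hα (f (diskPt p))) (sq_nonneg ‖deriv f (diskPt p)‖)
    have h2 : 0 ≤ c * ‖deriv f (diskPt p)‖ ^ 2 := by positivity
    linarith
  rw [integral_const_mul] at hb
  rw [discIntegral, abs_mul, abs_of_nonneg (by positivity : (0 : ℝ) ≤ (2 * Real.pi)⁻¹)]
  calc _ ≤ (2 * Real.pi)⁻¹ * (c * ∫ p, p.2.1 * p.2.2 * (2 * ‖deriv f (diskPt p)‖ ^ 2)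
        ∂boxMeasure) := by gcongr
    _ = c * (Real.circleAverage (fun w => ‖rePart (f w)‖ ^ 2) 0 1 - ‖rePart (f 0)‖ ^ 2) := by
      rw [← hE]; ring
    _ ≤ c * R ^ 2 := by
      gcongr
      have := circleAverage_norm_rePart_sq_le hR hf
      have := sq_nonneg ‖rePart (f 0)‖
      linarith
    _ = _ := mul_comm _ _

/-- On the boundary of a holomorphic disc the real part and the center control the second moment. -/
theorem circleAverage_norm_sq_le (hf : ContDiff ℂ 2 f) {R : ℝ}
    (hR : ∀ w : ℂ, ‖w‖ = 1 → ‖rePart (f w)‖ ≤ R) :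
    Real.circleAverage (fun w => ‖f w‖ ^ 2) 0 1 ≤ 2 * R ^ 2 + ‖f 0‖ ^ 2 := by
  -- Multiplying by `i` turns imaginary parts into real parts up to sign and preserves `‖f'‖`. Hence
  -- the means of `‖Im f‖²` and `‖Re f‖²` exceed their central values by the same amount.
  have hg : ContDiff ℂ 2 fun w => Complex.I • f w := hf.const_smul Complex.I
  have h1 := integral_norm_deriv_sq hf
  have h2 := integral_norm_deriv_sq hg
  have hd : ∀ w, ‖deriv (fun w => Complex.I • f w) w‖ = ‖deriv f w‖ := by
    intro w
    rw [deriv_fun_const_smul _ ((hf.differentiable (by norm_num)) w), norm_smul]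
    simp
  simp only [hd] at h2
  rw [h1] at h2
  have hc1 : Continuous fun w => ‖rePart (f w)‖ ^ 2 :=
    ((continuous_rePart.comp hf.continuous).norm).pow 2
  have hc2 : Continuous fun w => ‖rePart (Complex.I • f w)‖ ^ 2 :=
    ((continuous_rePart.comp hg.continuous).norm).pow 2
  have h3 := Real.circleAverage_fun_add (c := 0) (R := 1) hc1.continuousOn.circleIntegrable'
    hc2.continuousOn.circleIntegrable'
  simp only [norm_rePart_sq_add] at h3
  have h4 := circleAverage_norm_rePart_sq_le hR hf
  have h5 := norm_rePart_sq_add (f 0)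
  have h6 := sq_nonneg ‖rePart (f 0)‖
  rw [h3]
  linarith

end Bochner

/-! ### Loops near `K` and polynomial discs -/

namespace Bochner

set_option maxSynthPendingDepth 3

section Loops

/-- A connected compact set need not be path connected; its thickening is open and a union of balls
meeting the connected set `K`. -/
theorem isPathConnected_thickening {E : Type*} [NormedAddCommGroup E] [NormedSpace ℝ E]
    {K : Set E} (hK : IsConnected K) {ε : ℝ} (hε : 0 < ε) :
    IsPathConnected (Metric.thickening ε K) := by
  obtain ⟨k₀, hk₀⟩ := hK.nonempty
  refine (Metric.isOpen_thickening.isConnected_iff_isPathConnected).1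
    ⟨⟨k₀, Metric.self_subset_thickening hε K hk₀⟩, isPreconnected_of_forall k₀ fun y hy => ?_⟩
  obtain ⟨x, hx, hyx⟩ := Metric.mem_thickening_iff.1 hy
  refine ⟨K ∪ Metric.ball x ε, Set.union_subset (Metric.self_subset_thickening hε K)
    (Metric.ball_subset_thickening hx ε), Or.inl hk₀, Or.inr hyx, ?_⟩
  exact IsPreconnected.union x hx (Metric.mem_ball_self hε) hK.isPreconnected
    (convex_ball x ε).isPreconnected

/-- A continuous curve can be traversed in such a way that it spends nearly all of its time near
prescribed parameters, with prescribed weights. -/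
theorem exists_time_change {E : Type*} [NormedAddCommGroup E] [NormedSpace ℝ E] [CompleteSpace E]
    (N : ℕ) (c t : ℕ → ℝ) (hc : ∀ j, 0 ≤ c j) {Γ : ℝ → E} (hΓ : Continuous Γ) {B : ℝ}
    (hB : ∀ s, ‖Γ s‖ ≤ B) {ε : ℝ} (hε : 0 < ε) :
    ∃ τ : ℝ → ℝ, Continuous τ ∧ τ 0 = 0 ∧ τ (∑ j ∈ Finset.range N, c j) = 0 ∧
      ‖(∫ θ in (0 : ℝ)..∑ j ∈ Finset.range N, c j, Γ (τ θ)) -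
        ∑ j ∈ Finset.range N, c j • Γ (t j)‖ < ε := by
  let C : ℕ → ℝ := fun k => ∑ j ∈ Finset.range k, c j
  have hC0 : C 0 = 0 := Finset.sum_range_zero _
  have hCs : ∀ k, C (k + 1) = C k + c k := fun k => Finset.sum_range_succ _ _
  have hCm : Monotone C := monotone_nat_of_le_succ fun k => by rw [hCs]; linarith [hc k]
  -- A plateau on the `j`-th interval: zero at its ends and outside, and tending to `1` inside as `k
  -- → ∞`. Thus `τ k` rests at `t j` most of the time and returns to `0` between intervals.
  let h : ℕ → ℕ → ℝ → ℝ := fun k j θ => min 1 (k * max 0 (min (θ - C j) (C (j + 1) - θ)))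
  have hzero : ∀ k j θ, θ ≤ C j ∨ C (j + 1) ≤ θ → h k j θ = 0 := by
    intro k j θ hθ
    have : min (θ - C j) (C (j + 1) - θ) ≤ 0 := by
      rcases hθ with hθ | hθ
      · exact (min_le_left _ _).trans (by linarith)
      · exact (min_le_right _ _).trans (by linarith)
    simp [h, max_eq_left this]
  let τ : ℕ → ℝ → ℝ := fun k θ => ∑ j ∈ Finset.range N, t j * h k j θ
  have hτ : ∀ k, Continuous (τ k) := fun k => by fun_prop
  have hlim : ∀ j < N, Filter.Tendsto (fun k => ∫ θ in C j..C (j + 1), Γ (τ k θ)) Filter.atTop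
      (nhds (c j • Γ (t j))) := by
    intro j hj
    have e : c j • Γ (t j) = ∫ θ in C j..C (j + 1), Γ (t j) := by
      rw [intervalIntegral.integral_const, hCs, add_sub_cancel_left]
    rw [e]
    refine intervalIntegral.tendsto_integral_filter_of_dominated_convergence (fun _ => B)
      (Filter.Eventually.of_forall fun k => (hΓ.comp (hτ k)).aestronglyMeasurable)
      (Filter.Eventually.of_forall fun k => Filter.Eventually.of_forall fun θ _ => hB _)
      intervalIntegrable_const ?_
    have hne : ∀ᵐ θ : ℝ, θ ≠ C (j + 1) := by simp [ae_iff]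
    filter_upwards [hne] with θ hθ hθ'
    rw [Set.uIoc_of_le (hCm j.le_succ)] at hθ'
    have h1 : 0 < θ - C j := by linarith [hθ'.1]
    have h2 : 0 < C (j + 1) - θ := by
      have := lt_of_le_of_ne hθ'.2 hθ
      linarith
    have hd : 0 < min (θ - C j) (C (j + 1) - θ) := lt_min h1 h2
    obtain ⟨k₀, hk₀⟩ := exists_nat_ge (min (θ - C j) (C (j + 1) - θ))⁻¹
    refine tendsto_const_nhds.congr' ?_
    filter_upwards [Filter.eventually_ge_atTop k₀] with k hk
    have e1 : τ k θ = t j := by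
      change ∑ i ∈ Finset.range N, t i * h k i θ = t j
      rw [Finset.sum_eq_single j]
      · have : 1 ≤ (k : ℝ) * min (θ - C j) (C (j + 1) - θ) := by
          rw [← inv_le_iff_one_le_mul₀ hd]
          exact hk₀.trans (by exact_mod_cast hk)
        simp only [h, max_eq_right hd.le, min_eq_left this, mul_one]
      · intro i _ hij
        rw [hzero k i θ, mul_zero]
        rcases lt_or_gt_of_ne hij with hij | hij
        · exact Or.inr ((hCm hij).trans hθ'.1.le)
        · exact Or.inl (hθ'.2.trans (hCm hij))
      · intro hjN
        exact absurd (Finset.mem_range.2 hj) hjN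
    rw [e1]
  have hlim2 : Filter.Tendsto (fun k => ∫ θ in (0 : ℝ)..C N, Γ (τ k θ)) Filter.atTop
      (nhds (∑ j ∈ Finset.range N, c j • Γ (t j))) := by
    have := tendsto_finsetSum (Finset.range N) fun j hj => hlim j (Finset.mem_range.1 hj)
    refine this.congr fun k => ?_
    rw [intervalIntegral.sum_integral_adjacent_intervals, hC0]
    exact fun j _ => (hΓ.comp (hτ k)).intervalIntegrable _ _
  obtain ⟨k, hk⟩ := (Metric.tendsto_nhds.1 hlim2 ε hε).exists
  refine ⟨τ k, hτ k, Finset.sum_eq_zero fun j _ => ?_, Finset.sum_eq_zero fun j hj => ?_, ?_⟩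
  · rw [hzero k j 0 (Or.inl (hC0 ▸ hCm j.zero_le)), mul_zero]
  · rw [hzero k j _ (Or.inr (hCm (Finset.mem_range.1 hj))), mul_zero]
  · rw [← dist_eq_norm]
    exact hk

/-- Every point of the convex hull of a connected set is nearly the mean of a loop near the set. -/
theorem exists_loop_mean_near {E : Type*} [NormedAddCommGroup E] [NormedSpace ℝ E]
    [CompleteSpace E] {K : Set E} (hK : IsConnected K) {p : E} (hp : p ∈ convexHull ℝ K) {ε : ℝ}
    (hε : 0 < ε) :
    ∃ g : ℝ → E, Continuous g ∧ g 0 = g (2 * Real.pi) ∧ (∀ θ, g θ ∈ Metric.thickening ε K) ∧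
      ‖(∫ θ in (0 : ℝ)..2 * Real.pi, g θ) - (2 * Real.pi) • p‖ < ε := by
  obtain ⟨ι, _, z, w, hz, -, hw, hw1, hx⟩ := eq_pos_convex_span_of_mem_convexHull hp
  obtain ⟨N, hN⟩ : ∃ N, Fintype.card ι = N + 1 := by
    refine Nat.exists_eq_succ_of_ne_zero fun h0 => ?_
    have := Fintype.card_eq_zero_iff.1 h0
    simp at hw1
  let e : Fin (N + 1) ≃ ι := (Fintype.equivFinOfCardEq hN).symm
  obtain ⟨γ, t, hγ, ht⟩ := (isPathConnected_thickening hK hε).exists_path_through_family'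
    (fun i => z (e i)) fun i => Metric.self_subset_thickening hε K (hz (Set.mem_range_self _))
  let c' : ℕ → ℝ := fun j => if h : j < N + 1 then 2 * Real.pi * w (e ⟨j, h⟩) else 0
  let t' : ℕ → ℝ := fun j => if h : j < N + 1 then t ⟨j, h⟩ else 0
  have hc' : ∀ j, 0 ≤ c' j := by
    intro j
    by_cases h : j < N + 1
    · have := hw (e ⟨j, h⟩)
      simp only [c', h, dite_true]
      positivity
    · simp only [c', h, dite_false, le_refl]
  have hsum : ∑ j ∈ Finset.range (N + 1), c' j = 2 * Real.pi := by
    rw [← Fin.sum_univ_eq_sum_range]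
    simp only [c', Fin.is_lt, dite_true, Fin.eta, ← Finset.mul_sum]
    rw [e.sum_comp w, hw1, mul_one]
  have hΓ : Continuous γ.extend := γ.continuous_extend
  have hΓmem : ∀ s, γ.extend s ∈ Set.range γ := fun s => by
    rw [← γ.extend_range]; exact Set.mem_range_self s
  obtain ⟨B, hB⟩ := (isCompact_range γ.continuous).isBounded.exists_norm_le
  have hpsum : ∑ j ∈ Finset.range (N + 1), c' j • γ.extend (t' j) = (2 * Real.pi) • p := by
    rw [← Fin.sum_univ_eq_sum_range fun j => c' j • γ.extend (t' j)]
    have : ∀ i : Fin (N + 1), c' i • γ.extend (t' i) =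
        (2 * Real.pi) • (w (e i) • z (e i)) := by
      intro i
      simp only [c', t', Fin.is_lt, dite_true, Fin.eta]
      rw [Path.extend_apply _ (t i).2, mul_smul]
      exact congrArg _ (congrArg _ (ht i))
    simp only [this, ← Finset.smul_sum]
    rw [e.sum_comp fun i => w i • z i, hx]
  obtain ⟨τ, hτ, hτ0, hτ1, hτε⟩ := exists_time_change (N + 1) c' t' hc' hΓ
    (fun s => hB _ (hΓmem s)) hε
  rw [hsum] at hτ1 hτε
  rw [hpsum] at hτε
  -- `τ` starts and ends at `0`, so the composite closes up although `γ` itself is not a loop.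
  refine ⟨fun θ => γ.extend (τ θ), hΓ.comp hτ, by simp only [hτ0, hτ1], fun θ => ?_, hτε⟩
  obtain ⟨s, hs⟩ := hΓmem (τ θ)
  exact (hs ▸ hγ s : γ.extend (τ θ) ∈ _)

end Loops

section TrigonometricApproximation

/-- Negative frequencies are reflected by `Re(a e^{-imθ}) = Re(ā e^{imθ})`. The factor `a` carries
the induction through complex scalars. -/
theorem exists_polynomial_re_eq_of_mem_span [Fact (0 < 2 * Real.pi)]
    {F : C(AddCircle (2 * Real.pi), ℂ)} (hF : F ∈ Submodule.span ℂ (Set.range fourier)) (a : ℂ) :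
    ∃ P : Polynomial ℂ, ∀ x : AddCircle (2 * Real.pi),
      (P.eval (AddCircle.toCircle x : ℂ)).re = (a * F x).re := by
  induction hF using Submodule.span_induction generalizing a with
  | mem F hF =>
    obtain ⟨k, rfl⟩ := hF
    obtain ⟨m, rfl | rfl⟩ := k.eq_nat_or_neg
    · refine ⟨Polynomial.C a * Polynomial.X ^ m, fun x => ?_⟩
      simp [fourier_apply, AddCircle.toCircle_nsmul]
    · refine ⟨Polynomial.C (starRingEnd ℂ a) * Polynomial.X ^ m, fun x => ?_⟩
      rw [fourier_neg, ← Complex.conj_re]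
      simp [fourier_apply, AddCircle.toCircle_nsmul]
  | zero => exact ⟨0, fun x => by simp⟩
  | add F G _ _ hF hG =>
    obtain ⟨P, hP⟩ := hF a
    obtain ⟨Q, hQ⟩ := hG a
    exact ⟨P + Q, fun x => by simp [mul_add, hP, hQ]⟩
  | smul b F _ hF =>
    obtain ⟨P, hP⟩ := hF (a * b)
    exact ⟨P, fun x => by rw [hP]; simp [mul_assoc]⟩

/-- Continuous periodic functions are uniformly approximated by real parts of polynomials. -/
theorem exists_polynomial_re_near {g : ℝ → ℝ} (hg : Continuous g) (hp : g 0 = g (2 * Real.pi))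
    {ε : ℝ} (hε : 0 < ε) : ∃ P : Polynomial ℂ, ∀ θ ∈ Set.Icc 0 (2 * Real.pi),
      |(P.eval (circleMap 0 1 θ)).re - g θ| ≤ ε := by
  have : Fact (0 < 2 * Real.pi) := ⟨Real.two_pi_pos⟩
  let G : C(AddCircle (2 * Real.pi), ℂ) :=
    ⟨AddCircle.liftIco (2 * Real.pi) 0 fun θ => (g θ : ℂ),
      AddCircle.liftIco_zero_continuous (by rw [hp])
        (Complex.continuous_ofReal.comp hg).continuousOn⟩
  have hG : G ∈ (Submodule.span ℂ (Set.range <| @fourier (2 * Real.pi))).topologicalClosure := by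
    rw [span_fourier_closure_eq_top]; trivial
  obtain ⟨F, hF, hFG⟩ := Metric.mem_closure_iff.1 hG ε hε
  obtain ⟨P, hP⟩ := exists_polynomial_re_eq_of_mem_span hF 1
  have main : ∀ θ ∈ Set.Ico 0 (2 * Real.pi), |(P.eval (circleMap 0 1 θ)).re - g θ| ≤ ε := by
    intro θ hθ
    have h1 : circleMap 0 1 θ = AddCircle.toCircle (θ : AddCircle (2 * Real.pi)) := by
      rw [AddCircle.toCircle_apply_mk, div_self Real.two_pi_pos.ne']
      simp [circleMap]
    have h2 : G (θ : AddCircle (2 * Real.pi)) = g θ :=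
      AddCircle.liftIco_coe_apply (a := 0) (f := fun θ => (g θ : ℂ)) (by rwa [zero_add])
    have h3 := (ContinuousMap.dist_apply_le_dist (f := G) (g := F)
      (θ : AddCircle (2 * Real.pi))).trans hFG.le
    rw [h1, hP, one_mul]
    rw [dist_comm, Complex.dist_eq, h2] at h3
    simpa using (Complex.abs_re_le_norm _).trans h3
  refine ⟨P, fun θ hθ => ?_⟩
  rcases hθ.2.lt_or_eq with h | rfl
  · exact main θ ⟨hθ.1, h⟩
  · have := main 0 ⟨le_rfl, Real.two_pi_pos⟩
    rw [hp] at this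
    simpa [circleMap] using this

end TrigonometricApproximation

section Discs

variable {n : ℕ}

theorem norm_le_of_forall_abs_le {x : Rn n} {a : ℝ} (ha : 0 ≤ a) (h : ∀ j, |x j| ≤ a) :
    ‖x‖ ≤ (n + 1) * a := by
  rw [← pow_le_pow_iff_left₀ (norm_nonneg _) (by positivity) two_ne_zero,
    EuclideanSpace.norm_sq_eq]
  calc ∑ j, ‖x j‖ ^ 2 ≤ ∑ _j : Fin n, a ^ 2 :=
        Finset.sum_le_sum fun j _ => pow_le_pow_left₀ (norm_nonneg _) (h j) 2
    _ = n * a ^ 2 := by simp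
    _ ≤ _ := by nlinarith [sq_nonneg a, mul_nonneg (Nat.cast_nonneg (α := ℝ) n) (sq_nonneg a),
      mul_nonneg (sq_nonneg (n : ℝ)) (sq_nonneg a)]

theorem contDiff_eval (P : Polynomial ℂ) {k : WithTop ℕ∞} : ContDiff ℂ k fun w => P.eval w := by
  simpa using P.contDiff_aeval (𝕜 := ℂ) k

theorem re_eval_zero_eq (P : Polynomial ℂ) :
    ∫ θ in (0 : ℝ)..2 * Real.pi, (P.eval (circleMap 0 1 θ)).re =
      2 * Real.pi * (P.eval 0).re := by
  have hd : Differentiable ℂ fun w => P.eval w := P.differentiable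
  have h1 := (hd.diffContOnCl (s := Metric.ball 0 |1|)).circleAverage
  have h2 := Complex.reCLM.circleAverage_comp_comm (f := fun w => P.eval w) (c := 0) (R := 1)
    hd.continuous.continuousOn.circleIntegrable'
  rw [h1, Real.circleAverage_def] at h2
  have h3 : (2 * Real.pi)⁻¹ * ∫ θ in (0 : ℝ)..2 * Real.pi, (P.eval (circleMap 0 1 θ)).re =
    (P.eval 0).re := h2
  rw [← h3, mul_inv_cancel_left₀ (by positivity)]

/-- Polynomial discs with a given center and boundary close to the tube. -/
theorem exists_disc {K : Set (Rn n)} (hK : IsConnected K) {z₀ : Cn n}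
    (hz₀ : rePart z₀ ∈ convexHull ℝ K) {ε : ℝ} (hε : 0 < ε) :
    ∃ f : ℂ → Cn n, ContDiff ℂ 2 f ∧ f 0 = z₀ ∧
      ∀ w : ℂ, ‖w‖ = 1 → rePart (f w) ∈ Metric.cthickening ε K := by
  -- The loop is within `δ` of `K`; each coordinate errs by `δ` in the polynomial approximation and
  -- by `2δ` in the recentering.
  obtain ⟨δ, hδ, hδε⟩ : ∃ δ : ℝ, 0 < δ ∧ δ + (n + 1) * (3 * δ) ≤ ε := by
    refine ⟨ε / (1 + (n + 1) * 3), by positivity, le_of_eq ?_⟩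
    field_simp
  obtain ⟨g, hg, hgp, hgK, hgm⟩ := exists_loop_mean_near hK hz₀ hδ
  have hgj : ∀ j, Continuous fun θ => g θ j := fun j => by fun_prop
  have hP : ∀ j, ∃ P : Polynomial ℂ, ∀ θ ∈ Set.Icc 0 (2 * Real.pi),
      |(P.eval (circleMap 0 1 θ)).re - g θ j| ≤ δ := fun j =>
    exists_polynomial_re_near (hgj j) (by rw [hgp]) hδ
  choose P hP using hP
  have hmean : ∀ j, |(z₀ j).re - ((P j).eval 0).re| ≤ 2 * δ := by
    intro j
    have hgi : IntervalIntegrable g volume 0 (2 * Real.pi) := hg.intervalIntegrable _ _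
    have h1 : |(∫ θ in (0 : ℝ)..2 * Real.pi, g θ j) - 2 * Real.pi * (z₀ j).re| ≤ δ := by
      have h2 := (EuclideanSpace.proj j : Rn n →L[ℝ] ℝ).intervalIntegral_comp_comm hgi
      have h3 : (∫ θ in (0 : ℝ)..2 * Real.pi, g θ j) = (∫ θ in (0 : ℝ)..2 * Real.pi, g θ) j := h2
      have h4 := (PiLp.norm_apply_le
        ((∫ θ in (0 : ℝ)..2 * Real.pi, g θ) - (2 * Real.pi) • rePart z₀) j).trans hgm.le
      rw [h3]
      exact h4
    have h2 : |(∫ θ in (0 : ℝ)..2 * Real.pi, ((P j).eval (circleMap 0 1 θ)).re) -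
        ∫ θ in (0 : ℝ)..2 * Real.pi, g θ j| ≤ δ * (2 * Real.pi) := by
      have hPc : Continuous fun θ => ((P j).eval (circleMap 0 1 θ)).re :=
        Complex.continuous_re.comp ((P j).continuous.comp (continuous_circleMap 0 1))
      rw [← intervalIntegral.integral_sub (hPc.intervalIntegrable _ _)
        ((hgj j).intervalIntegrable _ _)]
      have := intervalIntegral.norm_integral_le_of_norm_le_const (a := 0) (b := 2 * Real.pi)
        (C := δ) (f := fun θ => ((P j).eval (circleMap 0 1 θ)).re - g θ j) fun θ hθ => by
          rw [Set.uIoc_of_le Real.two_pi_pos.le] at hθ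
          exact hP j θ ⟨hθ.1.le, hθ.2⟩
      rwa [sub_zero, abs_of_pos Real.two_pi_pos] at this
    rw [re_eval_zero_eq] at h2
    have hpi : 1 ≤ 2 * Real.pi := by linarith [Real.pi_gt_three]
    have h3 : 2 * Real.pi * |(z₀ j).re - ((P j).eval 0).re| ≤ 2 * Real.pi * (2 * δ) := by
      rw [← abs_of_pos Real.two_pi_pos, ← abs_mul, abs_of_pos Real.two_pi_pos, mul_sub, abs_le]
      rw [abs_le] at h1 h2
      have h5 : δ ≤ 2 * Real.pi * δ := le_mul_of_one_le_left hδ.le hpi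
      constructor <;> linarith [h1.1, h1.2, h2.1, h2.2]
    exact le_of_mul_le_mul_left h3 Real.two_pi_pos
  -- The constant term is replaced to make the center exact. By `hmean` this moves real parts by at
  -- most `2δ` per coordinate; the imaginary shift is harmless.
  refine ⟨fun w => WithLp.toLp 2 fun j => (P j).eval w - (P j).eval 0 + z₀ j, ?_, ?_, ?_⟩
  · rw [contDiff_euclidean]
    intro j
    exact ((contDiff_eval (P j)).sub contDiff_const).add contDiff_const
  · ext j
    simp
  · intro w hw
    have hw' : w ∈ circleMap 0 1 '' Set.Ioc 0 (2 * Real.pi) := by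
      rw [image_circleMap_Ioc]
      simpa using hw
    obtain ⟨θ, hθ, rfl⟩ := hw'
    have hd : ‖rePart (WithLp.toLp 2 fun j =>
        (P j).eval (circleMap 0 1 θ) - (P j).eval 0 + z₀ j : Cn n) - g θ‖ ≤
        (n + 1) * (3 * δ) := by
      refine norm_le_of_forall_abs_le (by positivity) fun j => ?_
      have h1 := hP j θ ⟨hθ.1.le, hθ.2⟩
      have h2 := hmean j
      have e : (rePart (WithLp.toLp 2 fun j =>
          (P j).eval (circleMap 0 1 θ) - (P j).eval 0 + z₀ j : Cn n) - g θ) j =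
          ((P j).eval (circleMap 0 1 θ)).re - ((P j).eval 0).re + (z₀ j).re - g θ j := rfl
      rw [e]
      rw [abs_le] at h1 h2 ⊢
      constructor <;> linarith [h1.1, h1.2, h2.1, h2.2]
    obtain ⟨x, hx, hxg⟩ := Metric.mem_thickening_iff.1 (hgK θ)
    refine Metric.mem_cthickening_of_dist_le _ x ε K hx ?_
    refine (dist_triangle _ (g θ) x).trans ?_
    rw [dist_eq_norm]
    linarith

end Discs

end Bochner

/-! ### Limits of discs: part (1) -/

namespace Bochner

set_option maxSynthPendingDepth 3

variable {n : ℕ} {f : ℂ → Cn n}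

/-- The maximum principle for the real part of a holomorphic disc. -/
theorem rePart_mem_of_forall_circle (hf : ContDiff ℂ 2 f) {S : Set (Rn n)} (hS : Convex ℝ S)
    (hSc : IsClosed S) (h : ∀ w : ℂ, ‖w‖ = 1 → rePart (f w) ∈ S) {ζ : ℂ} (hζ : ‖ζ‖ ≤ 1) :
    rePart (f ζ) ∈ S := by
  by_contra hx
  obtain ⟨ℓ, c, hℓS, hℓx⟩ := geometric_hahn_banach_closed_point hS hSc hx
  obtain ⟨e, he⟩ := (InnerProductSpace.toDual ℝ (Rn n)).surjective ℓ
  -- Exponentiating the complexified functional gives an entire function with modulus `exp(ℓ(Re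
  -- f))`, to which the maximum modulus principle applies.
  let F : ℂ → ℂ := fun w => Complex.exp (∑ j, (e j : ℂ) * f w j)
  have hnorm : ∀ w, ‖F w‖ = Real.exp (ℓ (rePart (f w))) := by
    intro w
    rw [Complex.norm_exp, ← he]
    congr 1
    simp [PiLp.inner_apply, rePart, mul_comm]
  have hfj : ∀ j, Differentiable ℂ fun w => f w j := fun j =>
    (differentiable_euclidean.1 (hf.differentiable (by norm_num))) j
  have hF : Differentiable ℂ F := by
    refine Differentiable.cexp (Differentiable.fun_sum fun j _ => ?_)
    exact (differentiable_const _).mul (hfj j)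
  have hb : ‖F ζ‖ ≤ Real.exp c := by
    refine Complex.norm_le_of_forall_mem_frontier_norm_le (Metric.isBounded_ball (x := 0) (r := 1))
      hF.diffContOnCl (fun w hw => ?_) ?_
    · rw [frontier_ball _ one_ne_zero, mem_sphere_zero_iff_norm] at hw
      rw [hnorm]
      exact Real.exp_le_exp.2 (hℓS _ (h w hw)).le
    · rw [closure_ball _ one_ne_zero]
      simpa using hζ
  rw [hnorm, Real.exp_le_exp] at hb
  exact hb.not_gt hℓx

/-- The boundary measure of a disc. -/
def circleMeasure (f : ℂ → Cn n) : Measure (Cn n) :=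
  Measure.map (f ∘ circleMap 0 1)
    (ENNReal.ofReal (2 * Real.pi)⁻¹ • volume.restrict (Set.Ioc 0 (2 * Real.pi)))

theorem isProbabilityMeasure_circleMeasure (hf : Continuous f) :
    IsProbabilityMeasure (circleMeasure f) := by
  constructor
  rw [circleMeasure, Measure.map_apply (hf.comp (continuous_circleMap 0 1)).measurable
    MeasurableSet.univ]
  simp only [Set.preimage_univ, Measure.smul_apply, Measure.restrict_apply MeasurableSet.univ,
    Set.univ_inter, Real.volume_Ioc, sub_zero, smul_eq_mul]
  rw [← ENNReal.ofReal_mul (by positivity), inv_mul_cancel₀ Real.two_pi_pos.ne',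
    ENNReal.ofReal_one]

theorem integral_circleMeasure (hf : Continuous f) {u : Cn n → ℝ} (hu : Continuous u) :
    ∫ z, u z ∂circleMeasure f = Real.circleAverage (fun w => u (f w)) 0 1 := by
  rw [circleMeasure, integral_map (hf.comp (continuous_circleMap 0 1)).aemeasurable
    hu.aestronglyMeasurable, integral_smul_measure, Real.circleAverage_def,
    intervalIntegral.integral_of_le Real.two_pi_pos.le, ENNReal.toReal_ofReal (by positivity)]
  rfl

theorem integrable_circleMeasure (hf : Continuous f) {u : Cn n → ℝ} (hu : Continuous u) :
    Integrable u (circleMeasure f) := by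
  have hc := hf.comp (continuous_circleMap 0 1)
  rw [circleMeasure, integrable_map_measure hu.aestronglyMeasurable hc.aemeasurable]
  refine Integrable.smul_measure ?_ ENNReal.ofReal_ne_top
  exact ((hu.comp hc).continuousOn.integrableOn_compact isCompact_Icc).mono_set
    Set.Ioc_subset_Icc_self

theorem circleMeasure_eq_zero (hf : Continuous f) {O : Set (Cn n)} (hO : MeasurableSet O)
    (h : ∀ w : ℂ, ‖w‖ = 1 → f w ∉ O) : circleMeasure f O = 0 := by
  have e : (f ∘ circleMap 0 1) ⁻¹' O = ∅ :=
    Set.eq_empty_of_forall_notMem fun θ hθ => h (circleMap 0 1 θ) (by simp) hθ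
  rw [circleMeasure, Measure.map_apply (hf.comp (continuous_circleMap 0 1)).measurable hO, e,
    measure_empty]

theorem isTightMeasureSet_of_integral_norm_sq_le {S : Set (Measure (Cn n))} {B : ℝ}
    (hi : ∀ μ ∈ S, Integrable (fun z => ‖z‖ ^ 2) μ) (hfin : ∀ μ ∈ S, IsFiniteMeasure μ)
    (hS : ∀ μ ∈ S, ∫ z, ‖z‖ ^ 2 ∂μ ≤ B) :
    IsTightMeasureSet S := by
  rw [isTightMeasureSet_iff_exists_isCompact_measure_compl_le]
  intro ε hε
  rcases eq_or_ne ε ⊤ with rfl | hε'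
  · exact ⟨∅, isCompact_empty, fun μ _ => le_top⟩
  have hε0 : 0 < ε.toReal := ENNReal.toReal_pos hε.ne' hε'
  set r : ℝ := Real.sqrt (|B| / ε.toReal + 1) with hr
  have hr2 : r ^ 2 = |B| / ε.toReal + 1 := Real.sq_sqrt (by positivity)
  have hrp : 0 < r ^ 2 := by rw [hr2]; positivity
  refine ⟨Metric.closedBall 0 r, isCompact_closedBall 0 r, fun μ hμ => ?_⟩
  have := hfin μ hμ
  have h1 := mul_meas_ge_le_integral_of_nonneg
    (Filter.Eventually.of_forall fun z => sq_nonneg ‖z‖) (hi μ hμ) (r ^ 2)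
  have h2 : (Metric.closedBall (0 : Cn n) r)ᶜ ⊆ {z | r ^ 2 ≤ ‖z‖ ^ 2} := by
    intro z hz
    have : r < ‖z‖ := by simpa using hz
    exact pow_le_pow_left₀ (Real.sqrt_nonneg _) this.le 2
  refine (measure_mono h2).trans ?_
  rw [← ENNReal.ofReal_toReal hε', ← ENNReal.ofReal_toReal (measure_ne_top μ _)]
  refine ENNReal.ofReal_le_ofReal ?_
  have h3 : r ^ 2 * μ.real {z | r ^ 2 ≤ ‖z‖ ^ 2} ≤ r ^ 2 * ε.toReal := by
    refine (h1.trans ((hS μ hμ).trans (le_abs_self B))).trans ?_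
    rw [hr2, add_mul, div_mul_cancel₀ _ hε0.ne']
    linarith
  exact le_of_mul_le_mul_left h3 hrp

/-- A linear functional on test forms bounded by the supremum norm is a current. -/
def currentOfBound (L : TestForm n 2 →ₗ[ℝ] ℝ) (C : ℝ)
    (h : ∀ (α : TestForm n 2) (c : ℝ), (∀ z, ‖α z‖ ≤ c) → |L α| ≤ C * c) : Current n where
  toLinearMap := L
  cont := by
    refine continuous_of_continuousAt_zero L.toAddMonoidHom ?_
    have hb : Continuous fun α : TestForm n 2 =>
        C * ‖TestFunction.toBoundedContinuousFunctionCLM ℝ α‖ :=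
      continuous_const.mul (TestFunction.toBoundedContinuousFunctionCLM ℝ).continuous.norm
    have h0 := hb.tendsto 0
    rw [map_zero, norm_zero, mul_zero] at h0
    rw [ContinuousAt, map_zero]
    refine squeeze_zero_norm (fun α => ?_) h0
    exact h α _ fun z =>
      BoundedContinuousFunction.norm_coe_le_norm (TestFunction.toBoundedContinuousFunctionCLM ℝ α) z

theorem exists_notMem_cthickening {S : Set (Rn n)} (hS : IsClosed S) {x : Rn n} (hx : x ∉ S) :
    ∃ m : ℕ, x ∉ Metric.cthickening (1 / ((m : ℝ) + 1)) S := by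
  rw [← hS.closure_eq, Metric.closure_eq_iInter_cthickening] at hx
  simp only [Set.mem_iInter, not_forall] at hx
  obtain ⟨δ, hδ, hx⟩ := hx
  obtain ⟨m, hm⟩ := exists_nat_one_div_lt hδ
  exact ⟨m, fun h => hx (Metric.cthickening_mono hm.le S h)⟩

/-- Limits of discs: a bounded sequence of holomorphic discs with common center subconverges to a
positive current together with a probability measure. -/
theorem exists_limit_current {z₀ : Cn n} {f : ℕ → ℂ → Cn n} (hf : ∀ k, ContDiff ℂ 2 (f k))
    (hf0 : ∀ k, f k 0 = z₀) {R : ℝ} (hR : ∀ k, ∀ w : ℂ, ‖w‖ = 1 → ‖rePart (f k w)‖ ≤ R) :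
    ∃ (T : Current n) (μ : ProbabilityMeasure (Cn n)),
      IsPositiveCurrent T ∧ mass T < ⊤ ∧
      (∀ φ : TestFn n, ddcCurrent T φ = (∫ z, φ z ∂(μ : Measure (Cn n))) - φ z₀) ∧
      (∀ α, (∀ᶠ k in Filter.atTop, discIntegral (f k) α = 0) → T α = 0) ∧
      ∀ O : Set (Cn n), IsOpen O → (∀ᶠ k in Filter.atTop, ∀ w : ℂ, ‖w‖ = 1 → f k w ∉ O) →
        (μ : Measure (Cn n)) O = 0 := by
  have hfc : ∀ k, Continuous (f k) := fun k => (hf k).continuous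
  let ν : ℕ → ProbabilityMeasure (Cn n) := fun k =>
    ⟨circleMeasure (f k), isProbabilityMeasure_circleMeasure (hfc k)⟩
  -- Along an ultrafilter the disc integrals of all test forms and the tight boundary measures
  -- converge at once, without diagonal extraction.
  let 𝒰 : Ultrafilter ℕ := Filter.hyperfilter ℕ
  have h𝒰 : (𝒰 : Filter ℕ) ≤ Filter.atTop := Nat.hyperfilter_le_atTop
  have hsq : Continuous fun z : Cn n => ‖z‖ ^ 2 := continuous_norm.pow 2
  have htight : IsTightMeasureSet
      {((μ : ProbabilityMeasure (Cn n)) : Measure (Cn n)) | μ ∈ Set.range ν} := by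
    refine isTightMeasureSet_of_integral_norm_sq_le (B := 2 * R ^ 2 + ‖z₀‖ ^ 2) ?_ ?_ ?_
    · rintro _ ⟨_, ⟨k, rfl⟩, rfl⟩
      exact integrable_circleMeasure (hfc k) hsq
    · rintro _ ⟨_, ⟨k, rfl⟩, rfl⟩
      infer_instance
    · rintro _ ⟨_, ⟨k, rfl⟩, rfl⟩
      change ∫ z, ‖z‖ ^ 2 ∂circleMeasure (f k) ≤ _
      rw [integral_circleMeasure (hfc k) hsq, ← hf0 k]
      exact circleAverage_norm_sq_le (hf k) (hR k)
  obtain ⟨μ, -, hμ⟩ := (isCompact_closure_of_isTightMeasureSet htight).ultrafilter_le_nhds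
    (𝒰.map ν) (Filter.le_principal_iff.2 (Filter.mem_map.2 (Filter.univ_mem'
      fun k => subset_closure (Set.mem_range_self k))))
  have hμ' : Filter.Tendsto ν 𝒰 (nhds μ) := hμ
  have hbd : ∀ (α : TestForm n 2) (c : ℝ), (∀ z, ‖α z‖ ≤ c) → ∀ k,
      |discIntegral (f k) α| ≤ R ^ 2 * c :=
    fun α c hα k => abs_discIntegral_le (hf k) (hR k) α hα
  have hex : ∀ α : TestForm n 2, ∃ x : ℝ,
      Filter.Tendsto (fun k => discIntegral (f k) α) 𝒰 (nhds x) := by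
    intro α
    obtain ⟨c, hc⟩ := α.continuous.bounded_above_of_compact_support α.hasCompactSupport
    obtain ⟨x, -, hx⟩ := (isCompact_Icc (a := -(R ^ 2 * c)) (b := R ^ 2 * c)).ultrafilter_le_nhds
      (𝒰.map fun k => discIntegral (f k) α) (Filter.le_principal_iff.2 (Filter.mem_map.2
        (Filter.univ_mem' fun k => abs_le.1 (hbd α c hc k))))
    exact ⟨x, hx⟩
  choose L hL using hex
  let L' : TestForm n 2 →ₗ[ℝ] ℝ :=
    { toFun := L
      map_add' := fun α β => tendsto_nhds_unique (hL (α + β)) (by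
        simp only [discIntegral_add (hf _)]
        exact (hL α).add (hL β))
      map_smul' := fun c α => tendsto_nhds_unique (hL (c • α)) (by
        simp only [discIntegral_smul]
        exact (hL α).const_mul c) }
  have hLb : ∀ (α : TestForm n 2) (c : ℝ), (∀ z, ‖α z‖ ≤ c) → |L' α| ≤ R ^ 2 * c :=
    fun α c hα => le_of_tendsto (hL α).abs (Filter.Eventually.of_forall (hbd α c hα))
  let T : Current n := currentOfBound L' (R ^ 2) hLb
  have hT : ∀ α, Filter.Tendsto (fun k => discIntegral (f k) α) 𝒰 (nhds (T α)) := hL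
  refine ⟨T, μ, ⟨?_, ?_⟩, ?_, ?_, ?_, ?_⟩
  · intro α hα
    refine tendsto_nhds_unique (hT α) ?_
    simp only [discIntegral_eq_zero_of_isTypeTwoZeroZeroTwo hα]
    exact tendsto_const_nhds
  · intro α _ hα
    exact ge_of_tendsto (hT α) (Filter.Eventually.of_forall fun k => discIntegral_nonneg hα)
  · refine lt_of_le_of_lt (iSup₂_le fun α hα => ?_) (ENNReal.ofReal_lt_top (r := R ^ 2 * 1))
    exact ENNReal.ofReal_le_ofReal ((le_abs_self _).trans (hLb α 1 hα))
  · intro φ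
    refine tendsto_nhds_unique (hT (ddc n φ)) ?_
    simp only [discIntegral_ddc (hf _), hf0]
    refine Filter.Tendsto.sub_const ?_ _
    have h1 := ProbabilityMeasure.tendsto_iff_forall_integral_tendsto.1 hμ'
      (TestFunction.toBoundedContinuousFunctionCLM ℝ φ)
    refine h1.congr fun k => ?_
    exact integral_circleMeasure (hfc k) φ.continuous
  · intro α hα
    refine tendsto_nhds_unique (hT α) ?_
    exact tendsto_const_nhds.congr' (Filter.Eventually.mono (h𝒰 hα) fun k hk => hk.symm)
  · intro O hO h
    -- Portmanteau: the limit gives an open set at most the lower limit of the masses.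
    have h1 := ProbabilityMeasure.le_liminf_measure_open_of_tendsto hμ' hO
    have h2 : (fun k => (ν k : Measure (Cn n)) O) =ᶠ[(𝒰 : Filter ℕ)] fun _ => 0 :=
      Filter.Eventually.mono (h𝒰 h) fun k hk =>
        circleMeasure_eq_zero (hfc k) hO.measurableSet hk
    rw [Filter.liminf_congr h2, Filter.liminf_const] at h1
    exact le_antisymm h1 zero_le

theorem exists_positive_current {K : Set (Rn n)} (hK : IsCompact K) (hconn : IsConnected K)
    {z₀ : Cn n} (hz₀ : rePart z₀ ∈ convexHull ℝ K) :
    ∃ T : Current n, IsPositiveCurrent T ∧ mass T < ⊤ ∧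
      dsupport T ⊆ tube (convexHull ℝ K) ∧
      ∃ μ : Measure (Cn n), IsProbabilityMeasure μ ∧ μ (tube K)ᶜ = 0 ∧
        ∀ φ : TestFn n, ddcCurrent T φ = (∫ z, φ z ∂μ) - φ z₀ := by
  have hε : ∀ k : ℕ, (0 : ℝ) < 1 / ((k : ℝ) + 1) := fun k => Nat.one_div_pos_of_nat
  choose f hf hf0 hfK using fun k : ℕ => exists_disc hconn hz₀ (hε k)
  have hmono : ∀ {m k : ℕ}, m ≤ k → ∀ S : Set (Rn n),
      Metric.cthickening (1 / ((k : ℝ) + 1)) S ⊆ Metric.cthickening (1 / ((m : ℝ) + 1)) S :=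
    fun h S => Metric.cthickening_mono (Nat.one_div_le_one_div h) S
  obtain ⟨R, hR⟩ := (hK.isBounded.cthickening (δ := 1)).exists_norm_le
  have hR' : ∀ k, ∀ w : ℂ, ‖w‖ = 1 → ‖rePart (f k w)‖ ≤ R := by
    intro k w hw
    have h1 := hmono k.zero_le K (hfK k w hw)
    simp only [Nat.cast_zero, zero_add, div_one] at h1
    exact hR _ h1
  obtain ⟨T, μ, hT, hm, hddc, hT0, hμ0⟩ := exists_limit_current hf hf0 hR'
  refine ⟨T, hT, hm, ?_, μ, inferInstance, ?_, hddc⟩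
  · intro z hz
    by_contra hzt
    obtain ⟨m, hm⟩ := exists_notMem_cthickening
      (isCompact_convexHull_of_finiteDimensional hK).isClosed hzt
    refine (notMem_dsupport_iff (f := T) z).2
      ⟨{y | rePart y ∉ Metric.cthickening (1 / ((m : ℝ) + 1)) (convexHull ℝ K)}, ?_,
        Metric.isClosed_cthickening.isOpen_compl.preimage continuous_rePart, hm⟩ hz
    intro α hα
    refine hT0 α ?_
    filter_upwards [Filter.eventually_ge_atTop m] with k hk
    refine discIntegral_eq_zero_of_disjoint fun ζ hζ hmem => hα hmem ?_
    refine hmono hk _ ?_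
    exact rePart_mem_of_forall_circle (hf k) ((convex_convexHull ℝ K).cthickening _)
      Metric.isClosed_cthickening
      (fun w hw => Metric.cthickening_subset_of_subset _ (subset_convexHull ℝ K) (hfK k w hw)) hζ
  -- The complement of the tube is a countable union of open sets, each eventually missed by the
  -- disc boundaries.
  · have hcov : (tube K)ᶜ ⊆
        ⋃ m : ℕ, {y : Cn n | rePart y ∉ Metric.cthickening (1 / ((m : ℝ) + 1)) K} := by
      intro z hz
      exact Set.mem_iUnion.2 (exists_notMem_cthickening hK.isClosed hz)
    refine measure_mono_null hcov (measure_iUnion_null fun m => ?_)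
    refine hμ0 _ (Metric.isClosed_cthickening.isOpen_compl.preimage continuous_rePart) ?_
    filter_upwards [Filter.eventually_ge_atTop m] with k hk w hw hmem
    exact hmem (hmono hk K (hfK k w hw))

end Bochner

end

theorem mainTheorem11 (n : ℕ) (K : Set (Bochner.Rn n)) (hK : IsCompact K)
    (hconn : IsConnected K) :
    (∀ z₀ : Bochner.Cn n, Bochner.rePart z₀ ∈ convexHull ℝ K →
      ∃ T : Bochner.Current n, Bochner.IsPositiveCurrent T ∧ Bochner.mass T < ⊤ ∧
        dsupport T ⊆ Bochner.tube (convexHull ℝ K) ∧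
        ∃ μ : Measure (Bochner.Cn n), IsProbabilityMeasure μ ∧ μ (Bochner.tube K)ᶜ = 0 ∧
          ∀ φ : Bochner.TestFn n, Bochner.ddcCurrent T φ = (∫ z, φ z ∂μ) - φ z₀) ∧
    (∀ T : Bochner.Current n, Bochner.IsPositiveCurrent T → Bochner.mass T < ⊤ →
      Bornology.IsBounded (Bochner.rePart '' dsupport T) →
      Bochner.IsNonposOn (Bochner.ddcCurrent T) (Bochner.tube K)ᶜ →
      dsupport T ⊆ Bochner.tube (convexHull ℝ K)) :=
  ⟨fun _ hz₀ => Bochner.exists_positive_current hK hconn hz₀,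
    fun _ hT hm hb hΩ => Bochner.dsupport_subset_tube_convexHull hK hT hm hb hΩ⟩
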